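/- **Conventions.** Let $\mathcal S$ be the space of complex-valued Schwartz functions on $\mathbb R$ and $\mathcal S'$ its dual, with $\langle f,\psi\rangle=\int f\psi$; $\widehat f(\omega)=\int f(x)e^{-i\omega x}dx$, $\mathcal F^{-1}\{g\}(x)=\frac1{2\pi}\int g(\omega)e^{i\omega x}d\omega$, extended to $\mathcal S'$ by duality. All complex powers are principal. For $a,b\in\mathbb C\setminus\{0\}$ and $\gamma\in\mathbb C$ put $h(\omega)=h^\gamma_{a,b}(\omega)=a|\omega|^\gamma$ for $\omega>0$, $b|\omega|^\gamma$ for $\omega<0$, and $h(0)=0$. For $\varphi\in\mathcal S$ and $k\in\mathbb N$ define $$(\mathrm D^\gamma_{a,b}\varphi)(x)=\tfrac1{2\pi}\int\widehat\varphi(\omega)h(\omega)e^{i\omega x}d\omega\qquad(\operatorname{Re}\gamma>-1),$$ $$(\mathrm I^{\gamma;k}_{a,b}\varphi)(x)=\tfrac1{2\pi}\int\widehat\varphi(\omega)\,\frac{e^{i\omega x}-\sum_{j=0}^{k-1}\frac{(ix)^j}{j!}\omega^j}{h(\omega)}d\omega,\qquad \mathrm I^{(\gamma;k)*}_{a,b}\varphi=\mathcal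 F^{-1}\Big\{\frac{\widehat\varphi(\cdot)-\sum_{j=0}^{k-1}\frac{\widehat\varphi^{(j)}(0)}{j!}(\cdot)^j}{h(-\,\cdot)}\Big\}\in\mathcal S'$$ (the last two for $\operatorname{Re}\gamma>0$). The *response* $\mathrm L\{\delta(\cdot-\tau)\}\in\mathcal S'$ of a linear operator $\mathrm L:\mathcal S\to\mathcal S'$ is the weak-* limit of $\mathrm L\varphi_n$ along all sequences $\varphi_n\in\mathcal S$ with $\varphi_n\ge0$, $\int\varphi_n=1$ and supports shrinking to $\{\tau\}$. Let $\binom zj=\frac{z(z-1)\cdots(z-j+1)}{j!}$, $\binom z0=1$, and $$K_{\mathrm D}(x,\tau)=\tfrac{\Gamma(\gamma+1)}{2\pi}\Big(\tfrac{a}{(i\tau-ix)^{\gamma+1}}+\tfrac{b}{(ix-i\tau)^{\gamma+1}}\Big),$$ $$K_{\mathrm I}(x,\tau)=\tfrac{\Gamma(1-\gamma)}{2\pi}\Big(\tfrac{(i\tau-ix)^{\gamma-1}}a+\tfrac{(ix-i\tau)^{\gamma-1}}b\Big)-\tfrac{\Gamma(1-\gamma)}{2\pi}\Big(\tfrac{(i\tau)^{\gamma-1}}a+\tfrac{(-i\tau)^{\gamma-1}}b\Big)\sum_{j=0}^{k-1}\tbinom{j-\gamma}{j}\big(\tfrac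 x\tau\big)^j,$$ $$K_{\mathrm I^*}(x,\tau)=\tfrac{\Gamma(1-\gamma)}{2\pi}\Big(\tfrac{(ix-i\tau)^{\gamma-1}}a+\tfrac{(i\tau-ix)^{\gamma-1}}b\Big)-\tfrac{\Gamma(1-\gamma)}{2\pi}\Big(\tfrac{(ix)^{\gamma-1}}a+\tfrac{(-ix)^{\gamma-1}}b\Big)\sum_{j=0}^{k-1}\tbinom{j-\gamma}{j}\big(\tfrac \tau x\big)^j.$$ For $\varepsilon>0$ let $K^\varepsilon_{\mathrm D},K^\varepsilon_{\mathrm I},K^\varepsilon_{\mathrm I^*}$ be obtained by expanding the products and replacing $\pm i(x-\tau)$ by $\varepsilon\pm i(x-\tau)$ and, in the correction sums, $(\pm i\tau)^{\gamma-1}(\frac x\tau)^j$ by $(\varepsilon\pm i\tau)^{\gamma-1}\big(\frac{\pm ix}{\varepsilon\pm i\tau}\big)^j$ (for $\mathrm I$) and $(\pm ix)^{\gamma-1}(\frac \tau x)^j$ by $(\varepsilon\pm ix)^{\gamma-1}\big(\frac{\pm i\tau}{\varepsilon\pm ix}\big)^j$ (for $\mathrm I^*$). **Theorem.** Let $a,b\in\mathbb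 C\setminus\{0\}$ and $\gamma\in\mathbb C\setminus\mathbb Z$. 1. Let $\operatorname{Re}\gamma>-1$. For every $\tau\in\mathbb R$ the response $\mathrm D^\gamma_{a,b}\{\delta(\cdot-\tau)\}$ exists, equals $\mathcal F^{-1}\{e^{-i\omega\tau}h(\omega)\}$, is the function $x\mapsto K_{\mathrm D}(x,\tau)$ on $\mathbb R\setminus\{\tau\}$, and on all of $\mathbb R$ is the limit of $K^\varepsilon_{\mathrm D}(\cdot,\tau)$ in $\mathcal S'$ as $\varepsilon\downarrow0$. For all $\varphi\in\mathcal S$: $(\mathrm D^\gamma_{a,b}\varphi)(x)=\int K_{\mathrm D}(x,\tau)\varphi(\tau)d\tau$ (absolutely convergent) if $x\notin\operatorname{supp}\varphi$, and $(\mathrm D^\gamma_{a,b}\varphi)(x)=\lim_{\varepsilon\downarrow0}\int K^\varepsilon_{\mathrm D}(x,\tau)\varphi(\tau)d\tau$ for every $x\in\mathbb R$. 2. Let $\operatorname{Re}\gamma>0$ and $k\ge\max(1,\lfloor\operatorname{Re}\gamma\rfloor)$. For every $\tau\ne0$ the response $\mathrm I^{\gamma;k}_{a,b}\{\delta(\cdot-\tau)\}$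 exists and is, on all of $\mathbb R$, the function $x\mapsto K_{\mathrm I}(x,\tau)$. If $\varphi\in\mathcal S$ and $0\notin\operatorname{supp}\varphi$, then $(\mathrm I^{\gamma;k}_{a,b}\varphi)(x)=\int K_{\mathrm I}(x,\tau)\varphi(\tau)d\tau$ (absolutely convergent) for every $x$; for every $\varphi\in\mathcal S$ and every $x$, $(\mathrm I^{\gamma;k}_{a,b}\varphi)(x)=\lim_{\varepsilon\downarrow0}\int K^\varepsilon_{\mathrm I}(x,\tau)\varphi(\tau)d\tau$. 3. Let $\operatorname{Re}\gamma>0$ and $k\ge\max(1,\lfloor\operatorname{Re}\gamma\rfloor)$. For every $\tau\in\mathbb R$ the response $\mathrm I^{(\gamma;k)*}_{a,b}\{\delta(\cdot-\tau)\}$ exists, equals $\mathcal F^{-1}\big\{\big(e^{-i\omega\tau}-\sum_{j<k}\frac{(-i\omega\tau)^j}{j!}\big)/h(-\omega)\big\}$, is the function $x\mapsto K_{\mathrm I^*}(x,\tau)$ on $\mathbb R\setminus\{0\}$, and on all of $\mathbb R$ is the limit of $K^\varepsilon_{\mathrm I^*}(\cdot,\tau)$ in $\mathcal S'$ as $\varepsilon\downarrow0$.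 For every $\varphi\in\mathcal S$, $\mathrm I^{(\gamma;k)*}_{a,b}\varphi$ is a tempered distribution; on $\mathbb R\setminus\{0\}$ it is the function $x\mapsto\int K_{\mathrm I^*}(x,\tau)\varphi(\tau)d\tau$ (absolutely convergent), and it is the limit in $\mathcal S'$ of $x\mapsto\int K^\varepsilon_{\mathrm I^*}(x,\tau)\varphi(\tau)d\tau$ as $\varepsilon\downarrow0$. -/

import Mathlib

open Filter Topology MeasureTheory
open scoped SchwartzMap

namespace ComplexFrac

noncomputable section

/-! ### Fourier transforms (angular frequency) -/

/-- `φ̂(ω) = ∫ φ(x) e^{-iωx} dx`. -/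
def angFourier (φ : ℝ → ℂ) (ω : ℝ) : ℂ :=
  ∫ x : ℝ, φ x * Complex.exp (-(Complex.I * ω * x))

/-- `(F⁻¹ ψ)(x) = (1/2π) ∫ ψ(ω) e^{iωx} dω`. -/
def invAngFourier (ψ : ℝ → ℂ) (x : ℝ) : ℂ :=
  1 / (2 * Real.pi) * ∫ ω : ℝ, ψ ω * Complex.exp (Complex.I * ω * x)

/-- The tempered distribution `U` is the inverse Fourier transform of the (locally integrable)
function `g`, in the distributional sense `⟨F⁻¹ g, ψ⟩ = ⟨g, F⁻¹ ψ⟩`. -/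
def IsInvFourier (g : ℝ → ℂ) (U : 𝓢'(ℝ, ℂ)) : Prop :=
  ∀ ψ : 𝓢(ℝ, ℂ), Integrable (fun ω => g ω * invAngFourier ψ ω) ∧
    U ψ = ∫ ω : ℝ, g ω * invAngFourier ψ ω

/-- The restriction of the tempered distribution `U` to the open set `s` is the function `f`. -/
def AgreesOn (U : 𝓢'(ℝ, ℂ)) (f : ℝ → ℂ) (s : Set ℝ) : Prop :=
  ∀ ψ : 𝓢(ℝ, ℂ), tsupport ψ ⊆ s →
    Integrable (fun x => f x * ψ x) ∧ U ψ = ∫ x : ℝ, f x * ψ x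

/-! ### The operators -/

/-- The homogeneous multiplier `h(ω) = a ω₊^γ + b ω₋^γ` for `ω ≠ 0`, `h(0) = 0`, where
`ω₊ ^ γ` is `|ω| ^ γ` on `ω > 0` and `ω₋ ^ γ` is `|ω| ^ γ` on `ω < 0`. -/
def homMult (a b γ : ℂ) (ω : ℝ) : ℂ :=
  if 0 < ω then a * (ω : ℂ) ^ γ else if ω < 0 then b * ((-ω : ℝ) : ℂ) ^ γ else 0

/-- The derivative `(D φ)(x) = (1/2π) ∫ φ̂(ω) h(ω) e^{iωx} dω`. -/
def fracD (a b γ : ℂ) (φ : 𝓢(ℝ, ℂ)) (x : ℝ) : ℂ :=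
  1 / (2 * Real.pi) *
    ∫ ω : ℝ, angFourier φ ω * homMult a b γ ω * Complex.exp (Complex.I * ω * x)

/-- The integrator
`(I φ)(x) = (1/2π) ∫ φ̂(ω) (e^{iωx} - ∑_{j<k} (ix)^j ω^j / j!) / h(ω) dω`. -/
def fracI (a b γ : ℂ) (k : ℕ) (φ : 𝓢(ℝ, ℂ)) (x : ℝ) : ℂ :=
  1 / (2 * Real.pi) *
    ∫ ω : ℝ, angFourier φ ω *
      ((Complex.exp (Complex.I * ω * x) -
        ∑ j ∈ Finset.range k, (Complex.I * x) ^ j / (j.factorial : ℂ) * (ω : ℂ) ^ j) /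
          homMult a b γ ω)

/-- `(g(ω) - ∑_{j<k} g⁽ʲ⁾(0) ω^j / j!) / h(-ω)`: for an input with Fourier transform `g`, the
Fourier transform of its image under the adjoint integrator. -/
def adjSymbol (a b γ : ℂ) (k : ℕ) (g : ℝ → ℂ) (ω : ℝ) : ℂ :=
  (g ω - ∑ j ∈ Finset.range k, iteratedDeriv j g 0 / (j.factorial : ℂ) * (ω : ℂ) ^ j) /
    homMult a b γ (-ω)

/-- The pairing `⟨f, ψ⟩ = ∫ f ψ`. -/
def pairing (f : ℝ → ℂ) (ψ : 𝓢(ℝ, ℂ)) : ℂ := ∫ x : ℝ, f x * ψ x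

/-- The adjoint integrator `I* φ`, a tempered distribution: `fracIAdj a b γ k φ ψ` is
`⟨I* φ, ψ⟩`, where `I* φ` is the distributional inverse Fourier transform of
`adjSymbol a b γ k φ̂`. -/
def fracIAdj (a b γ : ℂ) (k : ℕ) (φ ψ : 𝓢(ℝ, ℂ)) : ℂ :=
  ∫ ω : ℝ, adjSymbol a b γ k (angFourier φ) ω * invAngFourier ψ ω

/-! ### Response to a shifted Dirac impulse -/

/-- A sequence of nonnegative test functions of mass one with supports shrinking to `τ`, i.e. a
smooth approximation of `δ(· - τ)`. -/
def IsDeltaSequence (τ : ℝ) (φ : ℕ → 𝓢(ℝ, ℂ)) : Prop :=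
  (∀ n x, ∃ r : ℝ, 0 ≤ r ∧ φ n x = (r : ℂ)) ∧
  (∀ n, ∫ x : ℝ, φ n x = 1) ∧
  ∀ r : ℝ, 0 < r → ∀ᶠ n in atTop, tsupport (φ n) ⊆ Metric.ball τ r

/-- `U` is the response to `δ(· - τ)` of the linear operator `L : 𝓢 → 𝓢'`, given through
`L φ ψ = ⟨L φ, ψ⟩`: `L φₙ → U` in the weak-* sense along every smooth approximation `φₙ` of
`δ(· - τ)`. -/
def IsImpulseResponse (L : 𝓢(ℝ, ℂ) → 𝓢(ℝ, ℂ) → ℂ) (τ : ℝ) (U : 𝓢'(ℝ, ℂ)) : Prop :=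
  ∀ φ : ℕ → 𝓢(ℝ, ℂ), IsDeltaSequence τ φ →
    ∀ ψ : 𝓢(ℝ, ℂ), Tendsto (fun n => L (φ n) ψ) atTop (𝓝 (U ψ))

/-- The Fourier transform `e^{-iωτ}` of `δ(· - τ)`. -/
def fourierDirac (τ ω : ℝ) : ℂ := Complex.exp (-(Complex.I * ω * τ))

/-! ### The closed forms -/

/-- The generalized binomial coefficient `z (z-1) ⋯ (z-j+1) / j!`. -/
def genBinom (z : ℂ) (j : ℕ) : ℂ :=
  (∏ i ∈ Finset.range j, (z - i)) / (j.factorial : ℂ)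

def kernelD (a b γ : ℂ) (x τ : ℝ) : ℂ :=
  Complex.Gamma (γ + 1) / (2 * Real.pi) *
    (a / (Complex.I * τ - Complex.I * x) ^ (γ + 1) +
      b / (Complex.I * x - Complex.I * τ) ^ (γ + 1))

def kernelI (a b γ : ℂ) (k : ℕ) (x τ : ℝ) : ℂ :=
  Complex.Gamma (1 - γ) / (2 * Real.pi) *
    ((Complex.I * τ - Complex.I * x) ^ (γ - 1) / a +
      (Complex.I * x - Complex.I * τ) ^ (γ - 1) / b) -
  Complex.Gamma (1 - γ) / (2 * Real.pi) *
    ((Complex.I * τ) ^ (γ - 1) / a + (-(Complex.I * τ)) ^ (γ - 1) / b) *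
      ∑ j ∈ Finset.range k, genBinom (j - γ) j * ((x : ℂ) / τ) ^ j

def kernelIAdj (a b γ : ℂ) (k : ℕ) (x τ : ℝ) : ℂ :=
  Complex.Gamma (1 - γ) / (2 * Real.pi) *
    ((Complex.I * x - Complex.I * τ) ^ (γ - 1) / a +
      (Complex.I * τ - Complex.I * x) ^ (γ - 1) / b) -
  Complex.Gamma (1 - γ) / (2 * Real.pi) *
    ((Complex.I * x) ^ (γ - 1) / a + (-(Complex.I * x)) ^ (γ - 1) / b) *
      ∑ j ∈ Finset.range k, genBinom (j - γ) j * ((τ : ℂ) / x) ^ j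

/-! The generalized functions defined by the non-integer powers above, also across their
singular points, are boundary values: `± i y` is replaced by `ε ± i y` with `ε ↓ 0`. At `ε = 0`
the following three functions are the three kernels above. -/

def kernelDReg (a b γ : ℂ) (ε x τ : ℝ) : ℂ :=
  Complex.Gamma (γ + 1) / (2 * Real.pi) *
    (a / (ε + Complex.I * (τ - x)) ^ (γ + 1) +
      b / (ε + Complex.I * (x - τ)) ^ (γ + 1))

def kernelIReg (a b γ : ℂ) (k : ℕ) (ε x τ : ℝ) : ℂ :=
  Complex.Gamma (1 - γ) / (2 * Real.pi) *
    ((ε + Complex.I * (τ - x)) ^ (γ - 1) / a +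
      (ε + Complex.I * (x - τ)) ^ (γ - 1) / b) -
  Complex.Gamma (1 - γ) / (2 * Real.pi) *
    ∑ j ∈ Finset.range k, genBinom (j - γ) j *
      ((ε + Complex.I * τ) ^ (γ - 1) / a * (Complex.I * x / (ε + Complex.I * τ)) ^ j +
        (ε - Complex.I * τ) ^ (γ - 1) / b * (-(Complex.I * x) / (ε - Complex.I * τ)) ^ j)

def kernelIAdjReg (a b γ : ℂ) (k : ℕ) (ε x τ : ℝ) : ℂ :=
  Complex.Gamma (1 - γ) / (2 * Real.pi) *
    ((ε + Complex.I * (x - τ)) ^ (γ - 1) / a +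
      (ε + Complex.I * (τ - x)) ^ (γ - 1) / b) -
  Complex.Gamma (1 - γ) / (2 * Real.pi) *
    ∑ j ∈ Finset.range k, genBinom (j - γ) j *
      ((ε + Complex.I * x) ^ (γ - 1) / a * (Complex.I * τ / (ε + Complex.I * x)) ^ j +
        (ε - Complex.I * x) ^ (γ - 1) / b * (-(Complex.I * τ) / (ε - Complex.I * x)) ^ j)

end

end ComplexFrac

open ComplexFrac

open ComplexFrac

/-! Damping the frequency integral by $e^{-\varepsilon|\omega|}$ makes the kernels explicit. With
$R_k(z)=e^z-\sum_{j<k}z^j/j!$ (`expRem`), the integrator has symbol $R_k(ix\omega)/h(\omega)$. Its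
damped Fourier integral against $e^{-i\omega\tau}$ splits over the two half-lines into Laplace
transforms of $t^{-\gamma}R_k(\pm ixt)$ at $w=\varepsilon\pm i\tau$. For $\operatorname{Re}\gamma<1$
these are Gamma integrals term by term; for $\operatorname{Re}\gamma<k+1$ integration by parts
lowers $\gamma$ by one until that case is reached. The outcome is exactly the regularized kernel
(`kernelIReg_eq_integral`).

Fubini and dominated convergence on the Fourier side then give the $\varepsilon$-limit formula for
every $\varphi$ at every $x$ (`tendsto_integral_kernelIReg_mul`). Where the boundary powers have an
integrable majorant uniform in $\varepsilon$, the same limit passes under the kernel integral, which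
gives the closed form (`fracI_eq_integral_kernelI`).

The rest is duality. The derivative is the integrator of order $-\gamma$ with $k=0$ and coefficients
$a^{-1},b^{-1}$ (`fracD_eq`). The adjoint kernel is the integrator's kernel with its arguments
exchanged, and by `fracIAdj_eq_pairing` the adjoint's response at $\tau$ is $\psi\mapsto(\mathrm
I\psi)(\tau)$. The integrator's own response comes from Fubini and the continuity of $t\mapsto\int
K_{\mathrm I}(x,t)\psi(x)dx$ at $\tau\ne0$. -/

/-! ### Exponential remainders and their Laplace transforms. -/

open Set in
/-- The integral of `t ^ p * exp (-ε t)` over the half-line converges for `p > -1`. -/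
theorem integrableOn_rpow_mul_exp_neg {p ε : ℝ} (hp : -1 < p) (hε : 0 < ε) :
    IntegrableOn (fun t : ℝ => t ^ p * Real.exp (-(ε * t))) (Ioi 0) := by
  have := integrableOn_rpow_mul_exp_neg_mul_rpow hp one_pos hε
  simpa using this

/-- The remainder of the exponential series after `k` terms. -/
noncomputable def expRem (k : ℕ) (z : ℂ) : ℂ :=
  Complex.exp z - ∑ j ∈ Finset.range k, z ^ j / (j.factorial : ℂ)

theorem expRem_zero (z : ℂ) : expRem 0 z = Complex.exp z := by simp [expRem]

theorem expRem_succ (k : ℕ) (z : ℂ) :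
    expRem (k + 1) z = expRem k z - z ^ k / (k.factorial : ℂ) := by
  simp only [expRem, Finset.sum_range_succ]; ring

/-- Differentiation lowers the order by one; both the Taylor bound and the integration by parts rest
on this. -/
theorem hasDerivAt_expRem_succ (k : ℕ) (z : ℂ) :
    HasDerivAt (expRem (k + 1)) (expRem k z) z := by
  induction k with
  | zero =>
    have : expRem 1 = fun z => Complex.exp z - 1 := by
      funext z; simp [expRem]
    rw [expRem_zero, zero_add, this]
    exact (Complex.hasDerivAt_exp z).sub_const 1
  | succ k ih =>
    have h : expRem (k + 1 + 1) = fun z => expRem (k + 1) z - z ^ (k + 1) / ((k + 1).factorial : ℂ) := by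
      funext z; exact expRem_succ _ _
    rw [h, expRem_succ]
    refine ih.sub ?_
    have := (hasDerivAt_pow (k + 1) z).div_const ((k + 1).factorial : ℂ)
    refine this.congr_deriv ?_
    rw [Nat.factorial_succ]
    push_cast
    have h1 : (k.factorial : ℂ) ≠ 0 := by exact_mod_cast k.factorial_ne_zero
    have h2 : (k : ℂ) + 1 ≠ 0 := by exact_mod_cast k.succ_ne_zero
    field_simp

theorem continuous_expRem (k : ℕ) : Continuous (expRem k) := by
  unfold expRem; fun_prop

theorem expRem_succ_apply_zero (k : ℕ) : expRem (k + 1) 0 = 0 := by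
  simp [expRem, Finset.sum_range_succ']

/-- Induction by the mean value inequality, starting from $|e^{cy}|=1$ on the imaginary axis.
Bounding the derivative by its supremum loses the factor $1/k!$, which is not needed. -/
theorem norm_expRem_I_mul_le_of_nonneg (k : ℕ) (c : ℂ) (hc : c.re = 0) (hc' : ‖c‖ ≤ 1) {y : ℝ}
    (hy : 0 ≤ y) : ‖expRem k (c * y)‖ ≤ y ^ k := by
  induction k generalizing y with
  | zero => simp [expRem_zero, Complex.norm_exp, hc]
  | succ k ih =>
    have hd : ∀ t ∈ Set.Icc 0 y, HasDerivWithinAt (fun t : ℝ => expRem (k + 1) (c * t))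
        (expRem k (c * t) * c) (Set.Icc 0 y) t := by
      intro t _
      have h1 : HasDerivAt (fun t : ℝ => c * (t : ℂ)) c t := by
        simpa using (Complex.ofRealCLM.hasDerivAt (x := t)).const_mul c
      exact ((hasDerivAt_expRem_succ k _).comp t h1).hasDerivWithinAt
    have hb : ∀ t ∈ Set.Ico 0 y, ‖expRem k (c * t) * c‖ ≤ y ^ k := by
      intro t ht
      rw [norm_mul]
      calc _ ≤ t ^ k * 1 := mul_le_mul (ih ht.1) hc' (norm_nonneg _) (pow_nonneg ht.1 k)
        _ ≤ y ^ k := by rw [mul_one]; exact pow_le_pow_left₀ ht.1 ht.2.le k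
    have := norm_image_sub_le_of_norm_deriv_le_segment' hd hb y (Set.right_mem_Icc.2 hy)
    simpa [expRem_succ_apply_zero, pow_succ] using this

theorem norm_expRem_I_mul_le (k : ℕ) (y : ℝ) : ‖expRem k (Complex.I * y)‖ ≤ |y| ^ k := by
  rcases le_total 0 y with hy | hy
  · rw [abs_of_nonneg hy]
    exact norm_expRem_I_mul_le_of_nonneg k _ (by simp) (by simp) hy
  · rw [abs_of_nonpos hy]
    have := norm_expRem_I_mul_le_of_nonneg k (-Complex.I) (by simp) (by simp) (neg_nonneg.2 hy)
    simpa using this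

open Set in
/-- The Laplace integrand with a complex power. -/
theorem integrableOn_cpow_mul_exp_neg {a w : ℂ} (ha : -1 < a.re) (hw : 0 < w.re) :
    IntegrableOn (fun t : ℝ => (t : ℂ) ^ a * Complex.exp (-(w * t))) (Ioi 0) := by
  refine (integrableOn_rpow_mul_exp_neg ha hw).mono' ?_ ?_
  · refine ContinuousOn.aestronglyMeasurable ?_ measurableSet_Ioi
    refine ContinuousOn.mul ?_ (by fun_prop)
    intro t ht
    exact (Complex.continuousAt_ofReal_cpow_const t a (Or.inr (ne_of_gt ht))).continuousWithinAt
  · refine (ae_restrict_iff' measurableSet_Ioi).2 (ae_of_all _ fun t ht => ?_)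
    rw [norm_mul, Complex.norm_cpow_eq_rpow_re_of_pos ht, Complex.norm_exp]
    simp

-- Both sides are holomorphic in $w$ on the right half-plane and agree for real $w>0$, so the
-- identity theorem applies.
open Set in
theorem integral_cpow_mul_exp_neg {a w : ℂ} (ha : 0 < a.re) (hw : 0 < w.re) :
    ∫ t : ℝ in Ioi 0, (t : ℂ) ^ (a - 1) * Complex.exp (-(w * t)) =
      Complex.Gamma a * w ^ (-a) := by
  set G : ℂ → ℂ := fun w => ∫ t : ℝ in Ioi 0, (t : ℂ) ^ (a - 1) * Complex.exp (-(w * t)) with hG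
  set H : Set ℂ := {w | 0 < w.re} with hH
  have hHo : IsOpen H := isOpen_lt continuous_const Complex.continuous_re
  have hHc : IsPreconnected H := (convex_halfSpace_re_gt 0).isPreconnected
  have ha' : -1 < (a - 1).re := by simp; linarith
  have hdiff : DifferentiableOn ℂ G H := by
    intro w₀ hw₀
    have hw₀' : 0 < w₀.re / 2 := by have : 0 < w₀.re := hw₀; linarith
    refine DifferentiableAt.differentiableWithinAt ?_
    refine (hasDerivAt_integral_of_dominated_loc_of_deriv_le
      (μ := volume.restrict (Ioi (0 : ℝ)))
      (F := fun w (t : ℝ) => (t : ℂ) ^ (a - 1) * Complex.exp (-(w * t)))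
      (F' := fun w (t : ℝ) => (t : ℂ) ^ (a - 1) * (Complex.exp (-(w * t)) * (-t)))
      -- Staying in $\operatorname{Re}w>\operatorname{Re}w_0/2$ keeps a fixed exponential decay; the
      -- derivative in $w$ costs one power of $t$.
      (bound := fun t => t ^ a.re * Real.exp (-(w₀.re / 2 * t)))
      (s := {w : ℂ | w₀.re / 2 < w.re})
      ((isOpen_lt continuous_const Complex.continuous_re).mem_nhds
        (by simp only [mem_ofPred_eq]; linarith)) ?_
      (integrableOn_cpow_mul_exp_neg ha' hw₀) ?_ ?_ ?_ ?_).2.differentiableAt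
    · filter_upwards [hHo.mem_nhds hw₀] with w hw
      exact (integrableOn_cpow_mul_exp_neg ha' hw).1
    · refine ((integrableOn_cpow_mul_exp_neg ha' hw₀).1.mul
        (g := fun t : ℝ => -(t : ℂ)) (by fun_prop)).congr ?_
      exact ae_of_all _ fun t => by simp only [Pi.mul_apply]; ring
    · refine (ae_restrict_iff' measurableSet_Ioi).2 (ae_of_all _ fun t ht w hw => ?_)
      have ht' : 0 < t := ht
      rw [norm_mul, norm_mul, Complex.norm_cpow_eq_rpow_re_of_pos ht, Complex.norm_exp, norm_neg,
        Complex.norm_of_nonneg ht'.le]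
      have : t ^ a.re = t ^ (a - 1).re * t := by
        rw [← Real.rpow_add_one ht'.ne']; simp
      rw [this]
      have hw' : w₀.re / 2 < w.re := hw
      have : (-(w * (t : ℂ))).re ≤ -(w₀.re / 2 * t) := by
        simp; nlinarith
      have := Real.exp_le_exp.2 this
      have h0 : 0 ≤ t ^ (a - 1).re := Real.rpow_nonneg ht'.le _
      calc _ ≤ t ^ (a - 1).re * (Real.exp (-(w₀.re / 2 * t)) * t) := by gcongr
        _ = _ := by ring
    · exact integrableOn_rpow_mul_exp_neg (by linarith) hw₀'
    · refine ae_of_all _ fun t w _ => ?_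
      refine HasDerivAt.const_mul _ ?_
      refine HasDerivAt.cexp ?_
      simpa using ((hasDerivAt_id' w).mul_const (t : ℂ)).fun_neg
  have hR : DifferentiableOn ℂ (fun w => Complex.Gamma a * w ^ (-a)) H := by
    intro w hw
    refine DifferentiableAt.differentiableWithinAt ?_
    refine DifferentiableAt.const_mul ?_ _
    exact differentiableAt_id.cpow_const (Or.inl hw)
  refine (hdiff.analyticOnNhd hHo).eqOn_of_preconnected_of_frequently_eq (hR.analyticOnNhd hHo) hHc
    (z₀ := 1) (by simp [hH]) ?_ hw
  have hreal : ∀ r : ℝ, 0 < r → G r = Complex.Gamma a * (r : ℂ) ^ (-a) := by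
    intro r hr
    have := Complex.integral_cpow_mul_exp_neg_mul_Ioi ha hr
    rw [hG]
    simp only
    rw [this, mul_comm, Complex.cpow_neg, one_div, Complex.inv_cpow]
    rw [Complex.arg_ofReal_of_nonneg hr.le]; exact Real.pi_pos.ne
  have ht : Tendsto (fun r : ℝ => (r : ℂ)) (𝓝[>] 1) (𝓝[≠] 1) := by
    refine tendsto_nhdsWithin_iff.2 ⟨?_, ?_⟩
    · exact (Complex.continuous_ofReal.tendsto' 1 1 (by simp)).mono_left nhdsWithin_le_nhds
    · filter_upwards [self_mem_nhdsWithin] with r hr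
      have : r ≠ 1 := ne_of_gt hr
      simpa using this
  refine ht.frequently (Eventually.frequently ?_)
  filter_upwards [self_mem_nhdsWithin] with r hr
  exact hreal r (lt_trans one_pos hr)

theorem norm_expRem_I_mul_mul_le (k : ℕ) (x t : ℝ) :
    ‖expRem k (Complex.I * x * t)‖ ≤ |x| ^ k * |t| ^ k := by
  have := norm_expRem_I_mul_le k (x * t)
  rw [abs_mul, mul_pow] at this
  rwa [Complex.ofReal_mul, ← mul_assoc] at this

/-- The exponent $k-\operatorname{Re}\gamma$ exceeds $-1$ exactly when
$\operatorname{Re}\gamma<k+1$: this is the source of that recurring hypothesis. -/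
theorem norm_cpow_mul_expRem_le (k : ℕ) (x : ℝ) (γ : ℂ) {t : ℝ} (ht : 0 < t) :
    ‖(t : ℂ) ^ (-γ) * expRem k (Complex.I * x * t)‖ ≤ |x| ^ k * t ^ (k - γ.re) := by
  rw [norm_mul, Complex.norm_cpow_eq_rpow_re_of_pos ht]
  have h1 := norm_expRem_I_mul_mul_le k x t
  rw [abs_of_pos ht] at h1
  calc _ ≤ t ^ (-γ).re * (|x| ^ k * t ^ k) := by gcongr
    _ = |x| ^ k * t ^ (k - γ.re) := by
      rw [sub_eq_add_neg, Real.rpow_add ht, Real.rpow_natCast, Complex.neg_re]; ring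

open Set in
theorem continuousOn_cpow_mul_expRem (k : ℕ) (x : ℝ) (γ : ℂ) :
    ContinuousOn (fun t : ℝ => (t : ℂ) ^ (-γ) * expRem k (Complex.I * x * t)) (Ioi 0) := by
  refine ContinuousOn.mul ?_ ((continuous_expRem k).comp (by fun_prop)).continuousOn
  intro t ht
  exact (Complex.continuousAt_ofReal_cpow_const t _ (Or.inr (ne_of_gt ht))).continuousWithinAt

open Set in
theorem integrableOn_cpow_mul_expRem_mul_exp {k : ℕ} (x : ℝ) {γ w : ℂ} (hk : γ.re < k + 1)
    (hw : 0 < w.re) :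
    IntegrableOn (fun t : ℝ => (t : ℂ) ^ (-γ) * expRem k (Complex.I * x * t) *
      Complex.exp (-(w * t))) (Ioi 0) := by
  refine ((integrableOn_rpow_mul_exp_neg (p := k - γ.re) (by linarith) hw).const_mul
    (|x| ^ k)).mono' ?_ ?_
  · exact ContinuousOn.aestronglyMeasurable
      ((continuousOn_cpow_mul_expRem k x γ).mul (by fun_prop)) measurableSet_Ioi
  · refine (ae_restrict_iff' measurableSet_Ioi).2 (ae_of_all _ fun t ht => ?_)
    rw [norm_mul, ← mul_assoc]
    refine mul_le_mul (norm_cpow_mul_expRem_le k x γ ht) ?_ (norm_nonneg _)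
      (mul_nonneg (by positivity) (Real.rpow_nonneg (le_of_lt ht) _))
    rw [Complex.norm_exp]; simp

/-- The Laplace transform of `t ^ (-γ) * expRem k (I x t)`, in terms of the Gamma function. -/
noncomputable def laplaceExpRem (k : ℕ) (x : ℝ) (γ w : ℂ) : ℂ :=
  Complex.Gamma (1 - γ) * (w - Complex.I * x) ^ (γ - 1) -
    ∑ j ∈ Finset.range k, (Complex.I * x) ^ j / (j.factorial : ℂ) *
      (Complex.Gamma (1 - γ + j) * w ^ (γ - 1 - j))

/-- The closed form obeys the recursion that integration by parts gives for the integral, by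
$\Gamma(z+1)=z\Gamma(z)$; non-integrality of $\gamma$ keeps $1-\gamma+j\ne0$. -/
theorem laplaceExpRem_succ (m : ℕ) (x : ℝ) {γ w : ℂ} (hγ : ∀ n : ℤ, γ ≠ (n : ℂ))
    (hw : 0 < w.re) :
    (γ - 1) * laplaceExpRem (m + 1) x γ w =
      Complex.I * x * laplaceExpRem m x (γ - 1) w - w * laplaceExpRem (m + 1) x (γ - 1) w := by
  have hw0 : w ≠ 0 := by rintro rfl; simp at hw
  have hu0 : w - Complex.I * x ≠ 0 := by
    intro h; have := congrArg Complex.re h; simp at this; linarith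
  have hG : ∀ j : ℕ, Complex.Gamma (1 - (γ - 1) + j) =
      (1 - γ + j) * Complex.Gamma (1 - γ + j) := by
    intro j
    have h0 : (1 - γ + j) ≠ 0 := by
      intro h
      refine hγ (1 + j) ?_
      push_cast
      linear_combination -h
    rw [← Complex.Gamma_add_one _ h0]
    congr 1; ring
  have hG0 := hG 0
  simp only [Nat.cast_zero, add_zero] at hG0
  have e1 : (w - Complex.I * x) ^ (γ - 1 - 1) * (w - Complex.I * x) =
      (w - Complex.I * x) ^ (γ - 1) := by
    rw [Complex.cpow_sub _ _ hu0, Complex.cpow_one]; field_simp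
  have e2 : ∀ j : ℕ, w ^ (γ - 1 - 1 - j) * w = w ^ (γ - 1 - j) := by
    intro j
    rw [show γ - 1 - 1 - j = γ - 1 - j - 1 by ring, Complex.cpow_sub _ 1 hw0, Complex.cpow_one]
    field_simp
  unfold laplaceExpRem
  have hs : Complex.I * x * ∑ j ∈ Finset.range m, (Complex.I * x) ^ j / (j.factorial : ℂ) *
      (Complex.Gamma (1 - (γ - 1) + j) * w ^ (γ - 1 - 1 - j)) =
      ∑ j ∈ Finset.range (m + 1), j * ((Complex.I * x) ^ j / (j.factorial : ℂ) *
      (Complex.Gamma (1 - γ + j) * w ^ (γ - 1 - j))) := by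
    rw [Finset.sum_range_succ', Finset.mul_sum]
    simp only [Nat.cast_zero, zero_mul, add_zero]
    refine Finset.sum_congr rfl fun j _ => ?_
    have h1 : (j.factorial : ℂ) ≠ 0 := by exact_mod_cast j.factorial_ne_zero
    have h2 : (j : ℂ) + 1 ≠ 0 := by exact_mod_cast j.succ_ne_zero
    rw [Nat.factorial_succ, show 1 - (γ - 1) + (j : ℂ) = 1 - γ + ((j + 1 : ℕ) : ℂ) by
      push_cast; ring, show γ - 1 - 1 - (j : ℂ) = γ - 1 - ((j + 1 : ℕ) : ℂ) by push_cast; ring]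
    push_cast
    field_simp
    ring
  have hs' : w * ∑ j ∈ Finset.range (m + 1), (Complex.I * x) ^ j / (j.factorial : ℂ) *
      (Complex.Gamma (1 - (γ - 1) + j) * w ^ (γ - 1 - 1 - j)) =
      ∑ j ∈ Finset.range (m + 1), (1 - γ + j) * ((Complex.I * x) ^ j / (j.factorial : ℂ) *
      (Complex.Gamma (1 - γ + j) * w ^ (γ - 1 - j))) := by
    rw [Finset.mul_sum]
    refine Finset.sum_congr rfl fun j _ => ?_
    rw [hG, ← e2 j]; ring
  -- Uses $\gamma-1=j-(1-\gamma+j)$ in each term.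
  have hs'' : (γ - 1) * ∑ j ∈ Finset.range (m + 1), (Complex.I * x) ^ j / (j.factorial : ℂ) *
      (Complex.Gamma (1 - γ + j) * w ^ (γ - 1 - j)) =
      ∑ j ∈ Finset.range (m + 1), j * ((Complex.I * x) ^ j / (j.factorial : ℂ) *
      (Complex.Gamma (1 - γ + j) * w ^ (γ - 1 - j))) -
      ∑ j ∈ Finset.range (m + 1), (1 - γ + j) * ((Complex.I * x) ^ j / (j.factorial : ℂ) *
      (Complex.Gamma (1 - γ + j) * w ^ (γ - 1 - j))) := by
    rw [← Finset.sum_sub_distrib, Finset.mul_sum]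
    exact Finset.sum_congr rfl fun j _ => by ring
  rw [mul_sub, mul_sub, mul_sub, hs, hs', hs'', hG0, ← e1]
  ring

-- Integrates the derivative of $t^{1-\gamma}R_{m+1}(ixt)e^{-wt}$ over the half-line; both boundary
-- terms vanish.
open Set in
theorem integral_cpow_mul_expRem_mul_exp_succ (m : ℕ) (x : ℝ) {γ w : ℂ} (hγ1 : γ ≠ 1)
    (hk : γ.re < m + 2) (hw : 0 < w.re) :
    (γ - 1) * (∫ t : ℝ in Ioi 0, (t : ℂ) ^ (-γ) * expRem (m + 1) (Complex.I * x * t) *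
        Complex.exp (-(w * t))) =
      Complex.I * x * (∫ t : ℝ in Ioi 0, (t : ℂ) ^ (-(γ - 1)) * expRem m (Complex.I * x * t) *
        Complex.exp (-(w * t))) -
      w * ∫ t : ℝ in Ioi 0, (t : ℂ) ^ (-(γ - 1)) * expRem (m + 1) (Complex.I * x * t) *
        Complex.exp (-(w * t)) := by
  have hk1 : γ.re < ((m + 1 : ℕ) : ℝ) + 1 := by push_cast; linarith
  have hkm : (γ - 1).re < (m : ℝ) + 1 := by simp; linarith
  have hkm1 : (γ - 1).re < ((m + 1 : ℕ) : ℝ) + 1 := by push_cast; simp; linarith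
  have i1 := integrableOn_cpow_mul_expRem_mul_exp x hk1 hw
  have i2 := integrableOn_cpow_mul_expRem_mul_exp x hkm hw
  have i3 := integrableOn_cpow_mul_expRem_mul_exp x hkm1 hw
  set f : ℝ → ℂ := fun t => (t : ℂ) ^ (-(γ - 1)) * expRem (m + 1) (Complex.I * x * t) *
        Complex.exp (-(w * t)) with hf
  have hderiv : ∀ t ∈ Ioi (0 : ℝ), HasDerivAt f
      (-(γ - 1) * ((t : ℂ) ^ (-γ) * expRem (m + 1) (Complex.I * x * t) * Complex.exp (-(w * t))) +
        Complex.I * x * ((t : ℂ) ^ (-(γ - 1)) * expRem m (Complex.I * x * t) *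
          Complex.exp (-(w * t))) -
        w * ((t : ℂ) ^ (-(γ - 1)) * expRem (m + 1) (Complex.I * x * t) *
          Complex.exp (-(w * t)))) t := by
    intro t ht
    have ht0 : t ≠ 0 := ne_of_gt ht
    have h1 : HasDerivAt (fun t : ℝ => (t : ℂ) ^ (-(γ - 1))) (-(γ - 1) * (t : ℂ) ^ (-γ)) t := by
      have hne : -(γ - 1) ≠ 0 := fun h => hγ1 (by linear_combination -h)
      refine (hasDerivAt_ofReal_cpow_const (x := t) ht0 hne).congr_deriv ?_
      rw [show -(γ - 1) - 1 = -γ by ring]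
    have h2 : HasDerivAt (fun t : ℝ => expRem (m + 1) (Complex.I * x * t))
        (expRem m (Complex.I * x * t) * (Complex.I * x)) t := by
      have h1 : HasDerivAt (fun t : ℝ => Complex.I * x * (t : ℂ)) (Complex.I * x) t := by
        simpa using (Complex.ofRealCLM.hasDerivAt (x := t)).const_mul (Complex.I * x)
      exact (hasDerivAt_expRem_succ m _).comp t h1
    have h3 : HasDerivAt (fun t : ℝ => Complex.exp (-(w * t)))
        (Complex.exp (-(w * t)) * (-w)) t := by
      refine HasDerivAt.cexp ?_
      simpa using ((Complex.ofRealCLM.hasDerivAt (x := t)).const_mul w).fun_neg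
    refine ((h1.mul h2).mul h3).congr_deriv ?_
    simp only [Pi.mul_apply]
    ring
  have hint := ((i1.const_mul (-(γ - 1))).add (i2.const_mul (Complex.I * x))).sub (i3.const_mul w)
  have hf0 : f 0 = 0 := by simp [hf, expRem_succ_apply_zero]
  -- Near $0$ the function is $O(t^{m+2-\operatorname{Re}\gamma})$, a positive power.
  have hcont : ContinuousWithinAt f (Ici 0) 0 := by
    have hq : 0 < ((m + 1 : ℕ) : ℝ) - (γ - 1).re := by push_cast; simp; linarith
    have hg : Tendsto (fun t : ℝ => |x| ^ (m + 1) * t ^ (((m + 1 : ℕ) : ℝ) - (γ - 1).re))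
        (𝓝[Ici 0] 0) (𝓝 0) := by
      have := ((Real.continuousAt_rpow_const 0 _ (Or.inr hq.le)).tendsto.const_mul
        (|x| ^ (m + 1)))
      rw [Real.zero_rpow hq.ne', mul_zero] at this
      exact this.mono_left nhdsWithin_le_nhds
    rw [ContinuousWithinAt, hf0]
    refine squeeze_zero_norm' ?_ hg
    filter_upwards [self_mem_nhdsWithin] with t ht
    rcases eq_or_lt_of_le (show 0 ≤ t from ht) with h0 | h0
    · rw [← h0, hf0, Real.zero_rpow hq.ne']; simp
    · rw [hf, norm_mul]
      refine (mul_le_of_le_one_right (norm_nonneg _) ?_).trans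
        (norm_cpow_mul_expRem_le (m + 1) x (γ - 1) h0)
      rw [Complex.norm_exp]
      simp only [Complex.neg_re, Complex.mul_re, Complex.ofReal_re, Complex.ofReal_im, mul_zero,
        sub_zero, Real.exp_le_one_iff, Left.neg_nonpos_iff]
      positivity
  -- A function that is integrable together with its derivative tends to $0$ at infinity.
  have hlim : Tendsto f atTop (𝓝 0) :=
    tendsto_zero_of_hasDerivAt_of_integrableOn_Ioi hderiv hint i3
  have key := integral_Ioi_of_hasDerivAt_of_tendsto hcont hderiv hint hlim
  rw [integral_sub, integral_add, integral_const_mul, integral_const_mul, integral_const_mul,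
    hf0] at key
  · linear_combination -key
  · exact i1.const_mul _
  · exact i2.const_mul _
  · exact (i1.const_mul (-(γ - 1))).add (i2.const_mul (Complex.I * x))
  · exact i3.const_mul _

/-- For $\operatorname{Re}\gamma<1$ no cancellation at $0$ is needed: every term of the remainder is
integrable separately. -/
theorem integral_cpow_mul_expRem_mul_exp_of_re_lt_one (k : ℕ) (x : ℝ) {γ w : ℂ}
    (hk : γ.re < 1) (hw : 0 < w.re) :
    ∫ t : ℝ in Set.Ioi 0, (t : ℂ) ^ (-γ) * expRem k (Complex.I * x * t) *
      Complex.exp (-(w * t)) = laplaceExpRem k x γ w := by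
  have h1 : ∀ t ∈ Set.Ioi (0 : ℝ), (t : ℂ) ^ (-γ) * expRem k (Complex.I * x * t) *
      Complex.exp (-(w * t)) = (t : ℂ) ^ (-γ) * Complex.exp (-((w - Complex.I * x) * t)) -
      ∑ j ∈ Finset.range k, (Complex.I * x) ^ j / (j.factorial : ℂ) *
        ((t : ℂ) ^ (-γ + j) * Complex.exp (-(w * t))) := by
    intro t ht
    have ht0 : (t : ℂ) ≠ 0 := by exact_mod_cast (ne_of_gt ht)
    rw [expRem, mul_sub, sub_mul]
    congr 1
    · rw [mul_assoc, ← Complex.exp_add]; congr 2; ring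
    · rw [Finset.mul_sum, Finset.sum_mul]
      refine Finset.sum_congr rfl fun j _ => ?_
      rw [Complex.cpow_add _ _ ht0, Complex.cpow_natCast, mul_pow]
      ring
  have hwu : 0 < (w - Complex.I * x).re := by simpa using hw
  have hre : ∀ j : ℕ, 0 < (1 - γ + j).re := by
    intro j; simp; have : (0 : ℝ) ≤ j := j.cast_nonneg; linarith
  have hre' : ∀ j : ℕ, -1 < (-γ + j).re := by
    intro j; have := hre j; simp at this ⊢; linarith
  have hre0 : -1 < (-γ).re := by simpa using hk
  rw [setIntegral_congr_fun measurableSet_Ioi h1, integral_sub, integral_finsetSum]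
  · unfold laplaceExpRem
    congr 1
    · have := integral_cpow_mul_exp_neg (a := 1 - γ) (by simpa using hk) hwu
      rw [show 1 - γ - 1 = -γ by ring, show -(1 - γ) = γ - 1 by ring] at this
      exact this
    · refine Finset.sum_congr rfl fun j _ => ?_
      have := integral_cpow_mul_exp_neg (a := 1 - γ + j) (hre j) hw
      rw [show 1 - γ + j - 1 = -γ + j by ring, show -(1 - γ + (j : ℂ)) = γ - 1 - j by ring] at this
      rw [integral_const_mul, this]
  · exact fun j _ => (integrableOn_cpow_mul_exp_neg (hre' j) hw).const_mul _
  · exact integrableOn_cpow_mul_exp_neg hre0 hwu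
  · exact integrable_finsetSum _ fun j _ =>
      (integrableOn_cpow_mul_exp_neg (hre' j) hw).const_mul _

/-- The recursion for order $m+1$ calls both orders $m$ and $m+1$ at $\gamma-1$. The induction
therefore runs on a bound $n$ for $\operatorname{Re}\gamma$, with $k\ge n$ left free. -/
theorem integral_cpow_mul_expRem_mul_exp_aux (n : ℕ) {k : ℕ} (hnk : n ≤ k) (x : ℝ) {γ w : ℂ}
    (hγ : ∀ n : ℤ, γ ≠ (n : ℂ)) (hn : γ.re < n + 1) (hw : 0 < w.re) :
    ∫ t : ℝ in Set.Ioi 0, (t : ℂ) ^ (-γ) * expRem k (Complex.I * x * t) *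
      Complex.exp (-(w * t)) = laplaceExpRem k x γ w := by
  induction n generalizing k γ with
  | zero => exact integral_cpow_mul_expRem_mul_exp_of_re_lt_one k x (by simpa using hn) hw
  | succ n ih =>
    obtain ⟨m, rfl⟩ : ∃ m, k = m + 1 := ⟨k - 1, by omega⟩
    have hγ' : ∀ n : ℤ, γ - 1 ≠ (n : ℂ) := fun n h => hγ (n + 1) (by
      push_cast; linear_combination h)
    have hγ1 : γ ≠ 1 := by simpa using hγ 1
    have hn' : (γ - 1).re < n + 1 := by push_cast at hn; simp; linarith
    have hnm : n ≤ m := by omega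
    have hk : γ.re < m + 2 := by
      have : (n : ℝ) ≤ m := by exact_mod_cast hnm
      push_cast at hn; linarith
    refine mul_left_cancel₀ (sub_ne_zero.2 hγ1) ?_
    rw [integral_cpow_mul_expRem_mul_exp_succ m x hγ1 hk hw, laplaceExpRem_succ m x hγ hw,
      ih hnm hγ' hn', ih (by omega) hγ' hn']

theorem integral_cpow_mul_expRem_mul_exp {k : ℕ} (x : ℝ) {γ w : ℂ}
    (hγ : ∀ n : ℤ, γ ≠ (n : ℂ)) (hk : γ.re < k + 1) (hw : 0 < w.re) :
    ∫ t : ℝ in Set.Ioi 0, (t : ℂ) ^ (-γ) * expRem k (Complex.I * x * t) *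
      Complex.exp (-(w * t)) = laplaceExpRem k x γ w :=
  integral_cpow_mul_expRem_mul_exp_aux k le_rfl x hγ hk hw

/-- The functional equation yields $(1-\gamma)(2-\gamma)\cdots(j-\gamma)$, which read backwards is
the numerator of the binomial coefficient. -/
theorem Gamma_one_sub_add_natCast {γ : ℂ} (hγ : ∀ n : ℤ, γ ≠ (n : ℂ)) (j : ℕ) :
    Complex.Gamma (1 - γ + j) / (j.factorial : ℂ) = Complex.Gamma (1 - γ) * genBinom (j - γ) j := by
  have hp : Complex.Gamma (1 - γ + j) =
      Complex.Gamma (1 - γ) * ∏ i ∈ Finset.range j, (1 - γ + i) := by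
    induction j with
    | zero => simp
    | succ j ih =>
      have h0 : (1 - γ + j) ≠ 0 := fun h => hγ (1 + j) (by push_cast; linear_combination -h)
      rw [Finset.prod_range_succ, ← mul_assoc, ← ih, mul_comm, ← Complex.Gamma_add_one _ h0]
      congr 1; push_cast; ring
  rw [genBinom, hp, mul_div_assoc]
  congr 2
  rw [← Finset.prod_range_reflect]
  refine Finset.prod_congr rfl fun i hi => ?_
  have hi' : i < j := Finset.mem_range.1 hi
  rw [show j - 1 - i = j - (i + 1) by omega, Nat.cast_sub (by omega)]
  push_cast; ring

theorem laplaceExpRem_eq (k : ℕ) (x : ℝ) {γ : ℂ} (w : ℂ) (hγ : ∀ n : ℤ, γ ≠ (n : ℂ)) :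
    laplaceExpRem k x γ w = Complex.Gamma (1 - γ) * ((w - Complex.I * x) ^ (γ - 1) -
      ∑ j ∈ Finset.range k, genBinom (j - γ) j * ((Complex.I * x) ^ j * w ^ (γ - 1 - j))) := by
  rw [laplaceExpRem, mul_sub, Finset.mul_sum]
  congr 1
  refine Finset.sum_congr rfl fun j _ => ?_
  rw [← mul_assoc (Complex.Gamma (1 - γ)), ← Gamma_one_sub_add_natCast hγ]
  ring

/-! ### Tempered functions: integrability against Schwartz functions. -/

theorem integrable_of_integrableOn_Ioi {f : ℝ → ℂ} (h1 : IntegrableOn f (Set.Ioi 0))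
    (h2 : IntegrableOn (fun t => f (-t)) (Set.Ioi 0)) : Integrable f := by
  rw [← integrableOn_univ, ← Set.Iic_union_Ioi (a := (0 : ℝ))]
  refine IntegrableOn.union ?_ h1
  rw [integrableOn_Iic_iff_integrableOn_Iio]
  have := (Measure.measurePreserving_neg (volume : Measure ℝ)).integrableOn_comp_preimage
    (Homeomorph.neg ℝ).measurableEmbedding (f := f) (s := Set.Iio 0)
  rw [← this]
  simpa [Function.comp_def] using h2

theorem integral_eq_integral_Ioi_add {f : ℝ → ℂ} (hf : Integrable f) :
    ∫ x, f x = (∫ t in Set.Ioi 0, f t) + ∫ t in Set.Ioi 0, f (-t) := by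
  rw [integral_comp_neg_Ioi, neg_zero, add_comm, intervalIntegral.integral_Iic_add_Ioi
    hf.integrableOn hf.integrableOn]

theorem integrable_abs_rpow_mul_one_add_abs_rpow {p q : ℝ} (hp : -1 < p) (hpq : p + q < -1) :
    Integrable (fun x : ℝ => |x| ^ p * (1 + |x|) ^ q) := by
  have hq : q < 0 := by linarith
  have key : IntegrableOn (fun x : ℝ => |x| ^ p * (1 + |x|) ^ q) (Set.Ioi 0) := by
    have hm : Measurable (fun x : ℝ => |x| ^ p * (1 + |x|) ^ q) := by fun_prop
    rw [← Set.Ioc_union_Ioi_eq_Ioi (zero_le_one' ℝ)]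
    refine IntegrableOn.union ?_ ?_
    · have h := (intervalIntegral.intervalIntegrable_rpow' (a := 0) (b := 1) hp).1
      refine h.mono' hm.aestronglyMeasurable ?_
      refine (ae_restrict_iff' measurableSet_Ioc).2 (ae_of_all _ fun x hx => ?_)
      rw [Real.norm_of_nonneg (by positivity), abs_of_pos hx.1]
      refine mul_le_of_le_one_right (Real.rpow_nonneg hx.1.le _) ?_
      exact Real.rpow_le_one_of_one_le_of_nonpos (by linarith [hx.1]) hq.le
    · have h := integrableOn_Ioi_rpow_of_lt hpq one_pos
      refine h.mono' hm.aestronglyMeasurable ?_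
      refine (ae_restrict_iff' measurableSet_Ioi).2 (ae_of_all _ fun x hx => ?_)
      have hx0 : (0 : ℝ) < x := lt_trans one_pos hx
      rw [Real.norm_of_nonneg (by positivity), abs_of_pos hx0, Real.rpow_add hx0]
      refine mul_le_mul_of_nonneg_left ?_ (Real.rpow_nonneg hx0.le _)
      exact Real.rpow_le_rpow_of_nonpos hx0 (by linarith) hq.le
  have := integrable_of_integrableOn_Ioi
    (f := fun x : ℝ => ((|x| ^ p * (1 + |x|) ^ q : ℝ) : ℂ)) key.ofReal (by
      simp only [abs_neg]; exact key.ofReal)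
  simpa using this.re

theorem SchwartzMap.exists_norm_le_one_add_abs_rpow (φ : 𝓢(ℝ, ℂ)) (N : ℕ) :
    ∃ C : ℝ, 0 ≤ C ∧ ∀ x, ‖φ x‖ ≤ C * (1 + |x|) ^ (-(N : ℝ)) := by
  refine ⟨2 ^ N * (Finset.Iic (N, 0)).sup (fun m => SchwartzMap.seminorm ℂ m.1 m.2) φ,
    by positivity, fun x => ?_⟩
  have := SchwartzMap.one_add_le_sup_seminorm_apply (𝕜 := ℂ) (m := (N, 0)) (k := N) (n := 0)
    le_rfl le_rfl φ x
  rw [Real.rpow_neg (by positivity), ← div_eq_mul_inv, le_div_iff₀' (by positivity),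
    Real.rpow_natCast]
  simpa using this

/-- A function that is integrable against a negative power of `1 + |x|`. -/
def IsTempered (g : ℝ → ℂ) : Prop :=
  AEStronglyMeasurable g ∧ ∃ N : ℕ, Integrable (fun x => ‖g x‖ * (1 + |x|) ^ (-(N : ℝ)))

namespace IsTempered

variable {f g : ℝ → ℂ}

theorem mono (hg : IsTempered g) (hf : AEStronglyMeasurable f) (h : ∀ᵐ x, ‖f x‖ ≤ ‖g x‖) :
    IsTempered f := by
  obtain ⟨_, N, hN⟩ := hg
  refine ⟨hf, N, hN.mono' ?_ ?_⟩
  · exact hf.norm.mul (by fun_prop : Measurable _).aestronglyMeasurable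
  · filter_upwards [h] with x hx
    rw [Real.norm_of_nonneg (by positivity)]
    gcongr

theorem integrable_of_le (hg : IsTempered g) {N : ℕ}
    (hN : Integrable (fun x => ‖g x‖ * (1 + |x|) ^ (-(N : ℝ)))) {M : ℕ} (hM : N ≤ M) :
    Integrable (fun x => ‖g x‖ * (1 + |x|) ^ (-(M : ℝ))) := by
  refine hN.mono' ?_ (ae_of_all _ fun x => ?_)
  · exact hg.1.norm.mul (by fun_prop : Measurable _).aestronglyMeasurable
  · rw [Real.norm_of_nonneg (by positivity)]
    have : (N : ℝ) ≤ M := by exact_mod_cast hM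
    gcongr
    linarith [abs_nonneg x]

theorem add (hf : IsTempered f) (hg : IsTempered g) : IsTempered (fun x => f x + g x) := by
  obtain ⟨N, hN⟩ := hf.2
  obtain ⟨M, hM⟩ := hg.2
  have h1 := hf.integrable_of_le hN (le_max_left N M)
  have h2 := hg.integrable_of_le hM (le_max_right N M)
  refine ⟨hf.1.add hg.1, max N M, (h1.add h2).mono' ?_ (ae_of_all _ fun x => ?_)⟩
  · exact (hf.1.add hg.1).norm.mul (by fun_prop : Measurable _).aestronglyMeasurable
  · rw [Real.norm_of_nonneg (by positivity), Pi.add_apply, ← add_mul]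
    gcongr
    exact norm_add_le _ _

theorem const_mul (hf : IsTempered f) (c : ℂ) : IsTempered (fun x => c * f x) := by
  obtain ⟨N, hN⟩ := hf.2
  refine ⟨hf.1.const_mul c, N, ?_⟩
  simpa [mul_assoc] using hN.const_mul ‖c‖

theorem finset_sum {ι : Type*} (s : Finset ι) {f : ι → ℝ → ℂ} (h : ∀ i ∈ s, IsTempered (f i)) :
    IsTempered (fun x => ∑ i ∈ s, f i x) := by
  classical
  induction s using Finset.induction_on with
  | empty => exact ⟨by simpa using aestronglyMeasurable_const, 0, by simp⟩
  | insert i s hi ih =>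
    simp only [Finset.sum_insert hi]
    exact (h i (by simp)).add (ih fun j hj => h j (by simp [hj]))

theorem comp_sub_right (hf : IsTempered f) (t : ℝ) : IsTempered (fun x => f (x - t)) := by
  obtain ⟨N, hN⟩ := hf.2
  have hm : AEStronglyMeasurable (fun x => f (x - t)) :=
    hf.1.comp_quasiMeasurePreserving (measurePreserving_sub_right volume t).quasiMeasurePreserving
  refine ⟨hm, N, ((hN.comp_sub_right t).const_mul ((1 + |t|) ^ (N : ℝ))).mono' ?_
    (ae_of_all _ fun x => ?_)⟩
  · exact hm.norm.mul (by fun_prop : Measurable _).aestronglyMeasurable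
  · rw [Real.norm_of_nonneg (by positivity), mul_left_comm]
    refine mul_le_mul_of_nonneg_left ?_ (norm_nonneg _)
    rw [Real.rpow_neg (by positivity), Real.rpow_neg (by positivity), ← div_eq_mul_inv,
      le_div_iff₀ (by positivity), inv_mul_le_iff₀ (by positivity),
      ← Real.mul_rpow (by positivity) (by positivity)]
    refine Real.rpow_le_rpow (by positivity) ?_ (by positivity)
    -- The inequality $1+|x-t|\le(1+|t|)(1+|x|)$.
    nlinarith [abs_sub x t, abs_nonneg x, abs_nonneg t]

theorem comp_neg (hf : IsTempered f) : IsTempered (fun x => f (-x)) := by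
  obtain ⟨N, hN⟩ := hf.2
  refine ⟨hf.1.comp_quasiMeasurePreserving
    (Measure.measurePreserving_neg volume).quasiMeasurePreserving, N, ?_⟩
  simpa using hN.comp_neg

theorem integrable_mul (hg : IsTempered g) (φ : 𝓢(ℝ, ℂ)) : Integrable (fun x => g x * φ x) := by
  obtain ⟨N, hN⟩ := hg.2
  obtain ⟨C, hC, h⟩ := φ.exists_norm_le_one_add_abs_rpow N
  refine (hN.const_mul C).mono' (hg.1.mul φ.continuous.aestronglyMeasurable)
    (ae_of_all _ fun x => ?_)
  rw [norm_mul, mul_left_comm]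
  gcongr
  exact h x

/-- The tempered distribution given by integration against a tempered function. -/
theorem exists_distribution (hg : IsTempered g) :
    ∃ U : 𝓢(ℝ, ℂ) →L[ℂ] ℂ, ∀ ψ : 𝓢(ℝ, ℂ), U ψ = ∫ x, g x * ψ x := by
  obtain ⟨N, hN⟩ := hg.2
  refine ⟨SchwartzMap.mkCLMtoNormedSpace (fun ψ : 𝓢(ℝ, ℂ) => ∫ x, g x * ψ x) ?_ ?_ ?_,
    fun _ => rfl⟩
  · intro φ ψ
    rw [← integral_add (hg.integrable_mul φ) (hg.integrable_mul ψ)]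
    exact integral_congr_ae (ae_of_all _ fun x => by simp [mul_add])
  · intro c φ
    rw [RingHom.id_apply, smul_eq_mul, ← integral_const_mul]
    exact integral_congr_ae (ae_of_all _ fun x => by simp [mul_left_comm])
  · refine ⟨Finset.Iic (N, 0), 2 ^ N * ∫ x, ‖g x‖ * (1 + |x|) ^ (-(N : ℝ)), ?_, fun φ => ?_⟩
    · exact mul_nonneg (by positivity) (integral_nonneg fun x => by positivity)
    · set S := (Finset.Iic (N, 0)).sup (schwartzSeminormFamily ℂ ℝ ℂ) φ with hS
      have hb : ∀ x, ‖g x * φ x‖ ≤ 2 ^ N * S * (‖g x‖ * (1 + |x|) ^ (-(N : ℝ))) := by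
        intro x
        have := SchwartzMap.one_add_le_sup_seminorm_apply (𝕜 := ℂ) (m := (N, 0)) (k := N) (n := 0)
          le_rfl le_rfl φ x
        rw [norm_mul, mul_left_comm]
        refine mul_le_mul_of_nonneg_left ?_ (norm_nonneg _)
        rw [Real.rpow_neg (by positivity), ← div_eq_mul_inv, le_div_iff₀' (by positivity),
          Real.rpow_natCast]
        rw [norm_iteratedFDeriv_zero] at this
        exact this
      refine (norm_integral_le_of_norm_le (hN.const_mul _) (ae_of_all _ hb)).trans (le_of_eq ?_)
      rw [integral_const_mul]; ring

end IsTempered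

theorem isTempered_of_norm_le {f : ℝ → ℂ} (hf : AEStronglyMeasurable f) {p C : ℝ} (hp : -1 < p)
    (h : ∀ᵐ x : ℝ, ‖f x‖ ≤ C * |x| ^ p) : IsTempered f := by
  obtain ⟨N, hN⟩ := exists_nat_gt (p + 1)
  have hi := (integrable_abs_rpow_mul_one_add_abs_rpow (q := -(N : ℝ)) hp (by linarith)).const_mul C
  refine ⟨hf, N, hi.mono' (hf.norm.mul (by fun_prop : Measurable _).aestronglyMeasurable) ?_⟩
  filter_upwards [h] with x hx
  rw [Real.norm_of_nonneg (by positivity), ← mul_assoc]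
  gcongr

theorem isTempered_of_norm_le_one_add {f : ℝ → ℂ} (hf : AEStronglyMeasurable f) {p C : ℝ}
    (h : ∀ᵐ x : ℝ, ‖f x‖ ≤ C * (1 + |x|) ^ p) : IsTempered f := by
  obtain ⟨N, hN⟩ := exists_nat_gt (p + 1)
  have hi := (integrable_abs_rpow_mul_one_add_abs_rpow (p := 0) (q := p - N) (by norm_num)
    (by linarith)).const_mul C
  refine ⟨hf, N, hi.mono' (hf.norm.mul (by fun_prop : Measurable _).aestronglyMeasurable) ?_⟩
  filter_upwards [h] with x hx
  rw [Real.norm_of_nonneg (by positivity), Real.rpow_zero, one_mul, sub_eq_add_neg,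
    Real.rpow_add (by positivity), ← mul_assoc]
  gcongr

/-! ### Angular-frequency Fourier transforms on Schwartz space. -/

/-- The Fourier transform in the angular frequency, on Schwartz functions. -/
noncomputable def angFourierCLM : 𝓢(ℝ, ℂ) →L[ℂ] 𝓢(ℝ, ℂ) :=
  -- Mathlib's transform has kernel $e^{-2\pi i x\xi}$; setting $\xi=\omega/2\pi$ gives the angular
  -- one with no prefactor.
  (SchwartzMap.compCLMOfContinuousLinearEquiv ℂ (ContinuousLinearEquiv.unitsEquivAut ℝ
    (Units.mk0 (2 * Real.pi)⁻¹ (by positivity)))) ∘L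
      (FourierTransform.fourierCLM ℂ 𝓢(ℝ, ℂ))

theorem angFourierCLM_apply (φ : 𝓢(ℝ, ℂ)) (ω : ℝ) : angFourierCLM φ ω = angFourier φ ω := by
  have : angFourierCLM φ ω = FourierTransform.fourier (φ : ℝ → ℂ) (ω * (2 * Real.pi)⁻¹) := rfl
  rw [this, Real.fourier_real_eq_integral_exp_smul, angFourier]
  refine integral_congr_ae (ae_of_all _ fun x => ?_)
  simp only [smul_eq_mul]
  rw [mul_comm]
  congr 2
  push_cast
  have : (Real.pi : ℂ) ≠ 0 := by exact_mod_cast Real.pi_ne_zero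
  field_simp

theorem coe_angFourierCLM (φ : 𝓢(ℝ, ℂ)) : (angFourierCLM φ : ℝ → ℂ) = angFourier φ :=
  funext (angFourierCLM_apply φ)

theorem invAngFourier_eq (ψ : ℝ → ℂ) (ω : ℝ) :
    invAngFourier ψ ω = 1 / (2 * Real.pi) * angFourier ψ (-ω) := by
  rw [invAngFourier, angFourier]
  congr 1
  refine integral_congr_ae (ae_of_all _ fun x => ?_)
  simp only
  congr 2; push_cast; ring

/-- The inverse Fourier transform in the angular frequency, on Schwartz functions. -/
noncomputable def invAngFourierCLM : 𝓢(ℝ, ℂ) →L[ℂ] 𝓢(ℝ, ℂ) :=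
  (1 / (2 * Real.pi) : ℂ) • ((SchwartzMap.compCLMOfContinuousLinearEquiv ℂ
    (ContinuousLinearEquiv.neg ℝ)) ∘L angFourierCLM)

theorem invAngFourierCLM_apply (φ : 𝓢(ℝ, ℂ)) (ω : ℝ) :
    invAngFourierCLM φ ω = invAngFourier φ ω := by
  rw [invAngFourier_eq, ← angFourierCLM_apply]; rfl

/-- A tempered function is the Fourier transform of a tempered distribution. -/
theorem IsTempered.exists_isInvFourier {g : ℝ → ℂ} (hg : IsTempered g) :
    ∃ U : 𝓢'(ℝ, ℂ), IsInvFourier g U := by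
  obtain ⟨V, hV⟩ := hg.exists_distribution
  refine ⟨ContinuousLinearMap.toPointwiseConvergenceCLM _ _ _ _ (V ∘L invAngFourierCLM),
    fun ψ => ⟨?_, ?_⟩⟩
  · simpa only [invAngFourierCLM_apply] using hg.integrable_mul (invAngFourierCLM ψ)
  · refine (hV (invAngFourierCLM ψ)).trans ?_
    simp only [invAngFourierCLM_apply]

theorem IsTempered.exists_agreesOn {g : ℝ → ℂ} (hg : IsTempered g) :
    ∃ U : 𝓢'(ℝ, ℂ), (∀ ψ : 𝓢(ℝ, ℂ), U ψ = ∫ x, g x * ψ x) ∧ AgreesOn U g Set.univ := by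
  obtain ⟨V, hV⟩ := hg.exists_distribution
  exact ⟨ContinuousLinearMap.toPointwiseConvergenceCLM _ _ _ _ V, hV,
    fun ψ _ => ⟨hg.integrable_mul ψ, hV ψ⟩⟩

/-! ### The homogeneous multiplier and the symbol of the integrator. -/

theorem measurable_homMult (a b γ : ℂ) : Measurable (homMult a b γ) := by
  unfold homMult
  refine Measurable.ite measurableSet_Ioi (by fun_prop) ?_
  exact Measurable.ite measurableSet_Iio (by fun_prop) measurable_const

theorem homMult_of_pos (a b γ : ℂ) {t : ℝ} (ht : 0 < t) : homMult a b γ t = a * (t : ℂ) ^ γ := by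
  simp [homMult, ht]

theorem homMult_neg_of_pos (a b γ : ℂ) {t : ℝ} (ht : 0 < t) :
    homMult a b γ (-t) = b * (t : ℂ) ^ γ := by
  simp [homMult, ht, ht.le]

theorem homMult_zero (a b γ : ℂ) : homMult a b γ 0 = 0 := by simp [homMult]

theorem homMult_neg (a b γ : ℂ) (ω : ℝ) : homMult a b γ (-ω) = homMult b a γ ω := by
  rcases lt_trichotomy ω 0 with h | h | h
  · have h' : 0 < -ω := neg_pos.2 h
    rw [homMult_of_pos _ _ _ h', ← neg_neg ω, homMult_neg_of_pos _ _ _ h', neg_neg]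
  · simp [h, homMult_zero]
  · rw [homMult_of_pos _ _ _ h, homMult_neg_of_pos _ _ _ h]

/-- True at $\omega=0$ too, because $0^{-1}=0$. -/
theorem inv_homMult (a b γ : ℂ) (ω : ℝ) : (homMult a b γ ω)⁻¹ = homMult a⁻¹ b⁻¹ (-γ) ω := by
  unfold homMult
  split_ifs <;> simp [Complex.cpow_neg, mul_comm]

/-- The multiplier of the integrator, as a function of the evaluation point and the frequency. -/
noncomputable def intSymbol (a b γ : ℂ) (k : ℕ) (x ω : ℝ) : ℂ :=
  expRem k (Complex.I * x * ω) / homMult a b γ ω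

theorem measurable_intSymbol (a b γ : ℂ) (k : ℕ) :
    Measurable (fun p : ℝ × ℝ => intSymbol a b γ k p.1 p.2) := by
  refine Measurable.div ?_ ((measurable_homMult a b γ).comp measurable_snd)
  exact (continuous_expRem k).measurable.comp (by fun_prop)

theorem measurable_intSymbol_right (a b γ : ℂ) (k : ℕ) (x : ℝ) :
    Measurable (intSymbol a b γ k x) :=
  ((continuous_expRem k).measurable.comp (by fun_prop)).div (measurable_homMult a b γ)

theorem intSymbol_of_pos (a b γ : ℂ) (k : ℕ) (x : ℝ) {t : ℝ} (ht : 0 < t) :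
    intSymbol a b γ k x t = (t : ℂ) ^ (-γ) * expRem k (Complex.I * x * t) / a := by
  rw [intSymbol, homMult_of_pos _ _ _ ht, Complex.cpow_neg]
  field_simp

theorem intSymbol_neg_of_pos (a b γ : ℂ) (k : ℕ) (x : ℝ) {t : ℝ} (ht : 0 < t) :
    intSymbol a b γ k x (-t) =
      (t : ℂ) ^ (-γ) * expRem k (Complex.I * (-x : ℝ) * t) / b := by
  rw [intSymbol, homMult_neg_of_pos _ _ _ ht, Complex.cpow_neg]
  push_cast
  rw [show Complex.I * (x : ℂ) * -(t : ℂ) = Complex.I * (-x) * t by ring]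
  field_simp

theorem norm_intSymbol_le (a b γ : ℂ) (k : ℕ) (x ω : ℝ) :
    ‖intSymbol a b γ k x ω‖ ≤ (‖a‖⁻¹ + ‖b‖⁻¹) * |x| ^ k * |ω| ^ (k - γ.re) := by
  have ha : 0 ≤ ‖a‖⁻¹ := by positivity
  have hb : 0 ≤ ‖b‖⁻¹ := by positivity
  rcases lt_trichotomy ω 0 with h | h | h
  · have h' : 0 < -ω := neg_pos.2 h
    have h1 := norm_cpow_mul_expRem_le k (-x) γ h'
    have h2 := intSymbol_neg_of_pos a b γ k x h'
    rw [neg_neg] at h2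
    rw [h2, norm_div, div_eq_inv_mul, abs_of_neg h, mul_assoc (‖a‖⁻¹ + ‖b‖⁻¹)]
    rw [abs_neg] at h1
    refine mul_le_mul (by linarith) h1 (norm_nonneg _) (by positivity)
  · rw [h, intSymbol, homMult_zero, div_zero, norm_zero]; positivity
  · have h1 := norm_cpow_mul_expRem_le k x γ h
    rw [intSymbol_of_pos _ _ _ _ _ h, norm_div, div_eq_inv_mul, abs_of_pos h,
      mul_assoc (‖a‖⁻¹ + ‖b‖⁻¹)]
    refine mul_le_mul (by linarith) h1 (norm_nonneg _) (by positivity)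

theorem isTempered_intSymbol (a b γ : ℂ) {k : ℕ} (hk : γ.re < k + 1) (x : ℝ) :
    IsTempered (intSymbol a b γ k x) :=
  isTempered_of_norm_le (measurable_intSymbol_right a b γ k x).aestronglyMeasurable
    (p := k - γ.re) (by linarith) (ae_of_all _ (norm_intSymbol_le a b γ k x))

theorem fracI_eq (a b γ : ℂ) (k : ℕ) (φ : 𝓢(ℝ, ℂ)) (x : ℝ) :
    fracI a b γ k φ x =
      1 / (2 * Real.pi) * ∫ ω : ℝ, intSymbol a b γ k x ω * angFourierCLM φ ω := by
  rw [fracI]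
  congr 1
  refine integral_congr_ae (ae_of_all _ fun ω => ?_)
  simp only
  rw [angFourierCLM_apply, mul_comm, intSymbol, expRem]
  congr 3
  · ring_nf
  · exact Finset.sum_congr rfl fun j _ => by rw [mul_pow]; ring

/-- With $k=0$ no Taylor polynomial is subtracted, so results on the integrator cover the
derivative: $\operatorname{Re}\gamma>-1$ becomes $\operatorname{Re}(-\gamma)<0+1$. -/
theorem fracD_eq (a b γ : ℂ) (φ : 𝓢(ℝ, ℂ)) (x : ℝ) :
    fracD a b γ φ x = fracI a⁻¹ b⁻¹ (-γ) 0 φ x := by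
  rw [fracI, fracD]
  congr 1
  refine integral_congr_ae (ae_of_all _ fun ω => ?_)
  simp only [Finset.range_zero, Finset.sum_empty, sub_zero]
  rw [div_eq_mul_inv, inv_homMult, inv_inv, inv_inv, neg_neg]
  ring

/-- The multiplier `intSymbol` with an exponential cut-off in frequency. -/
theorem norm_intSymbol_mul_exp_le (a b γ : ℂ) (k : ℕ) (x ω ε : ℝ) (hε : 0 ≤ ε) :
    ‖intSymbol a b γ k x ω * Real.exp (-(ε * |ω|))‖ ≤ ‖intSymbol a b γ k x ω‖ := by
  rw [norm_mul]
  refine mul_le_of_le_one_right (norm_nonneg _) ?_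
  rw [Complex.norm_of_nonneg (Real.exp_nonneg _), Real.exp_le_one_iff]
  have : 0 ≤ ε * |ω| := by positivity
  linarith

theorem integrable_abs_rpow_mul_exp {p ε : ℝ} (hp : -1 < p) (hε : 0 < ε) :
    Integrable (fun ω : ℝ => |ω| ^ p * Real.exp (-(ε * |ω|))) := by
  have key : IntegrableOn (fun ω : ℝ => |ω| ^ p * Real.exp (-(ε * |ω|))) (Set.Ioi 0) := by
    refine (integrableOn_rpow_mul_exp_neg hp hε).congr_fun (fun t ht => ?_) measurableSet_Ioi
    simp only
    rw [abs_of_pos ht]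
  have := integrable_of_integrableOn_Ioi
    (f := fun x : ℝ => ((|x| ^ p * Real.exp (-(ε * |x|)) : ℝ) : ℂ)) key.ofReal (by
      simp only [abs_neg]; exact key.ofReal)
  exact (integrable_norm_iff this.1).2 this |>.congr (ae_of_all _ fun x => by
    exact Complex.norm_of_nonneg (by positivity))

theorem integrable_intSymbol_mul_exp (a b γ : ℂ) {k : ℕ} (hk : γ.re < k + 1) (x : ℝ) {ε : ℝ}
    (hε : 0 < ε) : Integrable (fun ω => intSymbol a b γ k x ω * Real.exp (-(ε * |ω|))) := by
  refine ((integrable_abs_rpow_mul_exp (p := k - γ.re) (by linarith) hε).const_mul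
    ((‖a‖⁻¹ + ‖b‖⁻¹) * |x| ^ k)).mono' ?_ (ae_of_all _ fun ω => ?_)
  · exact ((measurable_intSymbol_right a b γ k x).mul (by fun_prop)).aestronglyMeasurable
  · rw [norm_mul, Complex.norm_of_nonneg (Real.exp_nonneg _), ← mul_assoc]
    gcongr
    exact norm_intSymbol_le a b γ k x ω

/-! ### Regularized kernels as damped Fourier integrals. -/

/-- The power `(ε ± I y) ^ s`, with the sign `σ`. -/
noncomputable def boundaryPow (s : ℂ) (σ ε y : ℝ) : ℂ :=
  ((ε : ℂ) + Complex.I * ((σ * y : ℝ) : ℂ)) ^ s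

/-- At $z=0$ both sides vanish, since neither exponent is $0$; thus the identity survives at
$\varepsilon=0$ on the singular set. -/
theorem cpow_mul_div_pow {γ : ℂ} (hγ : ∀ n : ℤ, γ ≠ (n : ℂ)) (z u : ℂ) (j : ℕ) :
    z ^ (γ - 1) * (u / z) ^ j = u ^ j * z ^ (γ - 1 - j) := by
  by_cases hz : z = 0
  · have h1 : γ - 1 ≠ 0 := fun h => hγ 1 (by push_cast; linear_combination h)
    have h2 : γ - 1 - j ≠ 0 := fun h => hγ (1 + j) (by push_cast; linear_combination h)
    rw [hz, Complex.zero_cpow h1, Complex.zero_cpow h2]; simp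
  · rw [Complex.cpow_sub (γ - 1) _ hz, Complex.cpow_natCast, div_pow]; ring

/-- One of the two boundary values that make up the kernel of the integrator. -/
noncomputable def halfKernel (γ : ℂ) (k : ℕ) (σ ε x τ : ℝ) : ℂ :=
  boundaryPow (γ - 1) σ ε (τ - x) -
    ∑ j ∈ Finset.range k, genBinom (j - γ) j *
      ((Complex.I * ((σ * x : ℝ) : ℂ)) ^ j * boundaryPow (γ - 1 - j) σ ε τ)

theorem kernelIReg_eq (a b : ℂ) {γ : ℂ} (hγ : ∀ n : ℤ, γ ≠ (n : ℂ)) (k : ℕ) (ε x τ : ℝ) :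
    kernelIReg a b γ k ε x τ = Complex.Gamma (1 - γ) / (2 * Real.pi) *
      (halfKernel γ k 1 ε x τ / a + halfKernel γ k (-1) ε x τ / b) := by
  have e1 : ∀ j : ℕ, (ε + Complex.I * τ) ^ (γ - 1) / a * (Complex.I * x / (ε + Complex.I * τ)) ^ j
      = ((Complex.I * ((1 * x : ℝ) : ℂ)) ^ j * boundaryPow (γ - 1 - j) 1 ε τ) / a := by
    intro j
    rw [div_mul_eq_mul_div, cpow_mul_div_pow hγ, boundaryPow]
    push_cast; simp only [one_mul]
  have e2 : ∀ j : ℕ, (ε - Complex.I * τ) ^ (γ - 1) / b *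
      (-(Complex.I * x) / (ε - Complex.I * τ)) ^ j
      = ((Complex.I * ((-1 * x : ℝ) : ℂ)) ^ j * boundaryPow (γ - 1 - j) (-1) ε τ) / b := by
    intro j
    rw [div_mul_eq_mul_div, cpow_mul_div_pow hγ, boundaryPow]
    push_cast; simp only [neg_mul, one_mul, mul_neg, ← sub_eq_add_neg]
  have e3 : boundaryPow (γ - 1) 1 ε (τ - x) = (ε + Complex.I * (τ - x)) ^ (γ - 1) := by
    rw [boundaryPow]; push_cast; rw [one_mul]
  have e4 : boundaryPow (γ - 1) (-1) ε (τ - x) = (ε + Complex.I * (x - τ)) ^ (γ - 1) := by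
    rw [boundaryPow]; push_cast; congr 2; ring
  have hs : ∑ j ∈ Finset.range k, genBinom (j - γ) j *
      ((ε + Complex.I * τ) ^ (γ - 1) / a * (Complex.I * x / (ε + Complex.I * τ)) ^ j +
        (ε - Complex.I * τ) ^ (γ - 1) / b * (-(Complex.I * x) / (ε - Complex.I * τ)) ^ j) =
      (∑ j ∈ Finset.range k, genBinom (j - γ) j *
        ((Complex.I * ((1 * x : ℝ) : ℂ)) ^ j * boundaryPow (γ - 1 - j) 1 ε τ)) / a +
      (∑ j ∈ Finset.range k, genBinom (j - γ) j *
        ((Complex.I * ((-1 * x : ℝ) : ℂ)) ^ j * boundaryPow (γ - 1 - j) (-1) ε τ)) / b := by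
    rw [Finset.sum_div, Finset.sum_div, ← Finset.sum_add_distrib]
    refine Finset.sum_congr rfl fun j _ => ?_
    rw [e1, e2]; ring
  rw [kernelIReg, hs, halfKernel, halfKernel, e3, e4]
  ring

theorem kernelI_eq_kernelIReg (a b : ℂ) {γ : ℂ} (hγ : γ ≠ 1) (k : ℕ) (x τ : ℝ) :
    kernelI a b γ k x τ = kernelIReg a b γ k 0 x τ := by
  have h1 : γ - 1 ≠ 0 := sub_ne_zero.2 hγ
  unfold kernelI kernelIReg
  simp only [Complex.ofReal_zero, zero_add, zero_sub, neg_div_neg_eq,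
    mul_div_mul_left _ _ Complex.I_ne_zero, mul_sub]
  rw [mul_assoc, Finset.mul_sum]
  congr 2
  refine Finset.sum_congr rfl fun j _ => ?_
  ring

theorem kernelDReg_eq (a b γ : ℂ) (ε x τ : ℝ) :
    kernelDReg a b γ ε x τ = kernelIReg a⁻¹ b⁻¹ (-γ) 0 ε x τ := by
  simp only [kernelDReg, kernelIReg, Finset.range_zero, Finset.sum_empty, mul_zero, sub_zero,
    div_inv_eq_mul, sub_neg_eq_add, show -γ - 1 = -(γ + 1) by ring, Complex.cpow_neg,
    add_comm 1 γ]
  ring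

theorem kernelD_eq (a b γ : ℂ) (x τ : ℝ) :
    kernelD a b γ x τ = kernelI a⁻¹ b⁻¹ (-γ) 0 x τ := by
  simp only [kernelD, kernelI, Finset.range_zero, Finset.sum_empty, mul_zero, sub_zero,
    div_inv_eq_mul, sub_neg_eq_add, show -γ - 1 = -(γ + 1) by ring, Complex.cpow_neg,
    add_comm 1 γ]
  ring

/-- The Laplace formula at $w=\varepsilon+i\sigma\tau$, where $w-i\sigma x$ becomes
$\varepsilon+i\sigma(\tau-x)$. -/
theorem Gamma_mul_halfKernel {γ : ℂ} (hγ : ∀ n : ℤ, γ ≠ (n : ℂ)) {k : ℕ} (hk : γ.re < k + 1)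
    (σ x τ : ℝ) {ε : ℝ} (hε : 0 < ε) :
    Complex.Gamma (1 - γ) * halfKernel γ k σ ε x τ =
      ∫ t : ℝ in Set.Ioi 0, (t : ℂ) ^ (-γ) * expRem k (Complex.I * (σ * x : ℝ) * t) *
        Complex.exp (-(((ε : ℂ) + Complex.I * ((σ * τ : ℝ) : ℂ)) * t)) := by
  rw [integral_cpow_mul_expRem_mul_exp _ hγ hk (by simpa using hε), laplaceExpRem_eq _ _ _ hγ,
    halfKernel]
  congr 3
  rw [boundaryPow]
  congr 1
  push_cast; ring

/-- The regularized kernel of the integrator is an inverse Fourier integral. -/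
theorem kernelIReg_eq_integral (a b : ℂ) {γ : ℂ} (hγ : ∀ n : ℤ, γ ≠ (n : ℂ)) {k : ℕ}
    (hk : γ.re < k + 1) (x τ : ℝ) {ε : ℝ} (hε : 0 < ε) :
    kernelIReg a b γ k ε x τ = 1 / (2 * Real.pi) * ∫ ω : ℝ,
      intSymbol a b γ k x ω * Real.exp (-(ε * |ω|)) * fourierDirac τ ω := by
  have hint : Integrable (fun ω : ℝ =>
      intSymbol a b γ k x ω * Real.exp (-(ε * |ω|)) * fourierDirac τ ω) := by
    refine (integrable_intSymbol_mul_exp a b γ hk x hε).mul_bdd (c := 1) ?_ ?_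
    · unfold fourierDirac; fun_prop
    · exact ae_of_all _ fun ω => by simp [fourierDirac, Complex.norm_exp]
  -- Positive frequencies produce the term in $a$ with $\sigma=1$, negative ones the term in $b$
  -- with $\sigma=-1$.
  rw [integral_eq_integral_Ioi_add hint, kernelIReg_eq a b hγ]
  have h1 : ∫ ω in Set.Ioi (0 : ℝ), intSymbol a b γ k x ω * Real.exp (-(ε * |ω|)) *
      fourierDirac τ ω = Complex.Gamma (1 - γ) * halfKernel γ k 1 ε x τ / a := by
    rw [Gamma_mul_halfKernel hγ hk _ _ _ hε, ← integral_div]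
    refine setIntegral_congr_fun measurableSet_Ioi fun t ht => ?_
    rw [intSymbol_of_pos _ _ _ _ _ ht, fourierDirac, abs_of_pos ht, mul_assoc,
      Complex.ofReal_exp, ← Complex.exp_add, one_mul, one_mul, div_mul_eq_mul_div]
    congr 3
    push_cast; ring
  have h2 : ∫ ω in Set.Ioi (0 : ℝ), intSymbol a b γ k x (-ω) * Real.exp (-(ε * |-ω|)) *
      fourierDirac τ (-ω) = Complex.Gamma (1 - γ) * halfKernel γ k (-1) ε x τ / b := by
    rw [Gamma_mul_halfKernel hγ hk _ _ _ hε, ← integral_div]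
    refine setIntegral_congr_fun measurableSet_Ioi fun t ht => ?_
    rw [intSymbol_neg_of_pos _ _ _ _ _ ht, fourierDirac, abs_neg, abs_of_pos ht, mul_assoc,
      Complex.ofReal_exp, ← Complex.exp_add, neg_one_mul, neg_one_mul, div_mul_eq_mul_div]
    congr 3
    push_cast; ring
  rw [h1, h2]
  ring

theorem norm_fourierDirac (τ ω : ℝ) : ‖fourierDirac τ ω‖ = 1 := by
  simp [fourierDirac, Complex.norm_exp]

theorem continuous_fourierDirac : Continuous (fun p : ℝ × ℝ => fourierDirac p.1 p.2) := by
  unfold fourierDirac; fun_prop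

theorem angFourier_eq (φ : ℝ → ℂ) (ω : ℝ) :
    angFourier φ ω = ∫ τ, φ τ * fourierDirac τ ω := rfl

/-- Fubini's theorem for a Fourier integral. -/
theorem integral_integral_mul_fourierDirac {g φ : ℝ → ℂ} (hg : Integrable g)
    (hφ : Integrable φ) :
    ∫ τ, (∫ ω, g ω * fourierDirac τ ω) * φ τ = ∫ ω, g ω * angFourier φ ω := by
  have hint : Integrable (fun p : ℝ × ℝ => g p.2 * fourierDirac p.1 p.2 * φ p.1)
      (volume.prod volume) := by
    have h := (hφ.mul_prod hg).mul_bdd (c := 1)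
      continuous_fourierDirac.aestronglyMeasurable (ae_of_all _ fun p => (norm_fourierDirac _ _).le)
    exact h.congr (ae_of_all _ fun p => by ring)
  have h := integral_integral_swap (f := fun τ ω => g ω * fourierDirac τ ω * φ τ) hint
  simp only [angFourier_eq, ← integral_const_mul, ← integral_mul_const]
  rw [h]
  refine integral_congr_ae (ae_of_all _ fun ω => ?_)
  refine integral_congr_ae (ae_of_all _ fun τ => ?_)
  simp only; ring

/-! ### The limit of vanishing damping, and adjointness. -/

section

variable {a b γ : ℂ} {k : ℕ}

/-- The damped symbol is integrable, so Fubini moves the Fourier phase onto $\varphi$: integrating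
against the regularized kernel applies the integrator with damped symbol. -/
theorem integral_kernelIReg_mul (hγ : ∀ n : ℤ, γ ≠ (n : ℂ)) (hk : γ.re < k + 1)
    (φ : 𝓢(ℝ, ℂ)) (x : ℝ) {ε : ℝ} (hε : 0 < ε) :
    ∫ τ, kernelIReg a b γ k ε x τ * φ τ = 1 / (2 * Real.pi) *
      ∫ ω : ℝ, intSymbol a b γ k x ω * Real.exp (-(ε * |ω|)) * angFourierCLM φ ω := by
  simp only [kernelIReg_eq_integral a b hγ hk _ _ hε, mul_assoc, integral_const_mul]
  have := integral_integral_mul_fourierDirac (integrable_intSymbol_mul_exp a b γ hk x hε)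
    φ.integrable
  rw [coe_angFourierCLM]
  simp only [mul_assoc] at this
  rw [this]

theorem exists_norm_integral_intSymbol_le (hk : γ.re < k + 1) (φ : 𝓢(ℝ, ℂ)) :
    ∃ C : ℝ, 0 ≤ C ∧ ∀ x : ℝ, ∫ ω, ‖intSymbol a b γ k x ω * φ ω‖ ≤ C * |x| ^ k := by
  have hp : -1 < k - γ.re := by linarith
  have ht : IsTempered (fun ω : ℝ => ((|ω| ^ (k - γ.re) : ℝ) : ℂ)) :=
    isTempered_of_norm_le (by fun_prop : Measurable _).aestronglyMeasurable hp (C := 1)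
      (ae_of_all _ fun ω => by rw [one_mul, Complex.norm_of_nonneg (by positivity)])
  have hi := (ht.integrable_mul φ).norm.const_mul (‖a‖⁻¹ + ‖b‖⁻¹)
  refine ⟨∫ ω, (‖a‖⁻¹ + ‖b‖⁻¹) * ‖((|ω| ^ (k - γ.re) : ℝ) : ℂ) * φ ω‖,
    integral_nonneg fun _ => by positivity, fun x => ?_⟩
  rw [← integral_mul_const]
  refine integral_mono ((isTempered_intSymbol a b γ hk x).integrable_mul φ).norm
    (hi.mul_const _) fun ω => ?_
  simp only
  rw [norm_mul, norm_mul, Complex.norm_of_nonneg (by positivity)]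
  calc _ ≤ (‖a‖⁻¹ + ‖b‖⁻¹) * |x| ^ k * |ω| ^ (k - γ.re) * ‖φ ω‖ := by
        gcongr; exact norm_intSymbol_le a b γ k x ω
    _ = _ := by ring

/-- The multiplier at a frequency is continuous in the evaluation point. -/
theorem continuous_intSymbol_left (ω : ℝ) : Continuous (fun x => intSymbol a b γ k x ω) := by
  unfold intSymbol
  exact ((continuous_expRem k).comp (by fun_prop)).div_const _

/-- A Dirac sequence evaluates only at points of continuity; this serves the response of the
adjoint. -/
theorem continuous_fracI (hk : γ.re < k + 1) (φ : 𝓢(ℝ, ℂ)) : Continuous (fracI a b γ k φ) := by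
  rw [funext (fracI_eq a b γ k φ)]
  refine continuous_const.mul (continuous_iff_continuousAt.2 fun x₀ => ?_)
  have hp : -1 < k - γ.re := by linarith
  have ht : IsTempered (fun ω : ℝ => ((|ω| ^ (k - γ.re) : ℝ) : ℂ)) :=
    isTempered_of_norm_le (by fun_prop : Measurable _).aestronglyMeasurable hp (C := 1)
      (ae_of_all _ fun ω => by rw [one_mul, Complex.norm_of_nonneg (by positivity)])
  refine continuousAt_of_dominated (bound := fun ω => (‖a‖⁻¹ + ‖b‖⁻¹) * (|x₀| + 1) ^ k *
    ‖((|ω| ^ (k - γ.re) : ℝ) : ℂ) * angFourierCLM φ ω‖) ?_ ?_ ?_ ?_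
  · exact Eventually.of_forall fun x =>
      ((isTempered_intSymbol a b γ hk x).integrable_mul (angFourierCLM φ)).1
  · filter_upwards [Metric.ball_mem_nhds x₀ one_pos] with x hx
    refine ae_of_all _ fun ω => ?_
    have hx' : |x| ≤ |x₀| + 1 := by
      rw [Metric.mem_ball, Real.dist_eq] at hx
      have := abs_sub_abs_le_abs_sub x x₀
      linarith
    rw [norm_mul, norm_mul, Complex.norm_of_nonneg (by positivity), ← mul_assoc]
    gcongr
    refine (norm_intSymbol_le a b γ k x ω).trans ?_
    gcongr
  · exact (ht.integrable_mul _).norm.const_mul _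
  · exact ae_of_all _ fun ω =>
      ((continuous_intSymbol_left ω).mul continuous_const).continuousAt

/-- The bound is uniform in $\varepsilon$ and of polynomial growth in $x$, hence a majorant when the
limit is paired with a second Schwartz function. -/
theorem exists_norm_integral_kernelIReg_mul_le (hγ : ∀ n : ℤ, γ ≠ (n : ℂ)) (hk : γ.re < k + 1)
    (φ : 𝓢(ℝ, ℂ)) : ∃ C : ℝ, 0 ≤ C ∧ ∀ ε x : ℝ, 0 < ε →
      ‖∫ τ, kernelIReg a b γ k ε x τ * φ τ‖ ≤ C * |x| ^ k := by
  obtain ⟨C, hC, h⟩ := exists_norm_integral_intSymbol_le (a := a) (b := b) hk (angFourierCLM φ)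
  refine ⟨‖(1 / (2 * Real.pi) : ℂ)‖ * C, by positivity, fun ε x hε => ?_⟩
  rw [integral_kernelIReg_mul hγ hk φ x hε, norm_mul, mul_assoc]
  gcongr
  refine (norm_integral_le_of_norm_le
    ((isTempered_intSymbol a b γ hk x).integrable_mul (angFourierCLM φ)).norm
    (ae_of_all _ fun ω => ?_)).trans (h x)
  rw [norm_mul, norm_mul (intSymbol a b γ k x ω) (angFourierCLM φ ω)]
  exact mul_le_mul_of_nonneg_right (norm_intSymbol_mul_exp_le a b γ k x ω ε hε.le)
    (norm_nonneg _)

/-- The limit is taken on the Fourier side, dominated by the undamped integrand. No condition on the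
support of $\varphi$ arises, even where the limiting kernel is not integrable. -/
theorem tendsto_integral_kernelIReg_mul (hγ : ∀ n : ℤ, γ ≠ (n : ℂ)) (hk : γ.re < k + 1)
    (φ : 𝓢(ℝ, ℂ)) (x : ℝ) :
    Tendsto (fun ε : ℝ => ∫ τ, kernelIReg a b γ k ε x τ * φ τ) (𝓝[>] 0)
      (𝓝 (fracI a b γ k φ x)) := by
  rw [fracI_eq]
  have key : Tendsto (fun ε : ℝ => ∫ ω : ℝ, intSymbol a b γ k x ω * Real.exp (-(ε * |ω|)) *
      angFourierCLM φ ω) (𝓝[>] 0) (𝓝 (∫ ω : ℝ, intSymbol a b γ k x ω * angFourierCLM φ ω)) := by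
    have hi := (isTempered_intSymbol a b γ hk x).integrable_mul (angFourierCLM φ)
    refine tendsto_integral_filter_of_dominated_convergence _ ?_ ?_ hi.norm ?_
    · refine Eventually.of_forall fun ε => ?_
      exact (((measurable_intSymbol_right a b γ k x).mul (by fun_prop)).mul
        (angFourierCLM φ).continuous.measurable).aestronglyMeasurable
    · filter_upwards [self_mem_nhdsWithin] with ε hε
      refine ae_of_all _ fun ω => ?_
      rw [norm_mul, norm_mul (intSymbol a b γ k x ω) (angFourierCLM φ ω)]
      exact mul_le_mul_of_nonneg_right (norm_intSymbol_mul_exp_le a b γ k x ω ε (le_of_lt hε))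
        (norm_nonneg _)
    · refine ae_of_all _ fun ω => Tendsto.mono_left ?_ nhdsWithin_le_nhds
      refine Continuous.tendsto' (by fun_prop) _ _ ?_
      simp
  refine (key.const_mul (1 / (2 * Real.pi) : ℂ)).congr' ?_
  filter_upwards [self_mem_nhdsWithin] with ε hε
  rw [integral_kernelIReg_mul hγ hk φ x hε]

theorem integral_intSymbol_neg_mul (ψ : 𝓢(ℝ, ℂ)) (x : ℝ) :
    ∫ ω : ℝ, intSymbol a b γ k x (-ω) * invAngFourierCLM ψ ω = fracI a b γ k ψ x := by
  rw [fracI_eq, ← integral_const_mul, ← integral_neg_eq_self]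
  refine integral_congr_ae (ae_of_all _ fun ω => ?_)
  simp only
  rw [invAngFourierCLM_apply, invAngFourier_eq, neg_neg, angFourierCLM_apply]
  ring

theorem iteratedDeriv_fourierDirac (τ : ℝ) (j : ℕ) :
    iteratedDeriv j (fourierDirac τ) 0 = (-(Complex.I * τ)) ^ j := by
  have h : ∀ j : ℕ, iteratedDeriv j (fourierDirac τ) =
      fun ω => (-(Complex.I * τ)) ^ j * fourierDirac τ ω := by
    intro j
    induction j with
    | zero => simp
    | succ j ih =>
      rw [iteratedDeriv_succ, ih]
      funext ω
      have h1 : HasDerivAt (fun ω : ℝ => -(Complex.I * ω * τ)) (-(Complex.I * τ)) ω := by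
        simpa using (((Complex.ofRealCLM.hasDerivAt (x := ω)).const_mul Complex.I).mul_const
          (τ : ℂ)).fun_neg
      have h2 : HasDerivAt (fourierDirac τ) (fourierDirac τ ω * -(Complex.I * τ)) ω := h1.cexp
      rw [(h2.const_mul _).deriv]
      ring
  rw [h]
  simp [fourierDirac]

/-- The Taylor polynomial of $\omega\mapsto e^{-i\omega\tau}$ at $0$ is the truncated exponential
series in $-i\omega\tau$, so the two symbols differ only by reflecting the frequency. -/
theorem adjSymbol_fourierDirac (τ ω : ℝ) :
    adjSymbol a b γ k (fourierDirac τ) ω = intSymbol a b γ k τ (-ω) := by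
  rw [adjSymbol, intSymbol, expRem]
  congr 2
  · rw [fourierDirac]; congr 1; push_cast; ring
  · refine Finset.sum_congr rfl fun j _ => ?_
    rw [iteratedDeriv_fourierDirac, div_mul_eq_mul_div, ← mul_pow]
    congr 2; push_cast; ring

theorem iteratedDeriv_angFourier (φ : 𝓢(ℝ, ℂ)) (j : ℕ) :
    iteratedDeriv j (angFourier φ) 0 = ∫ τ : ℝ, (-(Complex.I * τ)) ^ j * φ τ := by
  have h0 : angFourier φ = fun ω => FourierTransform.fourier (φ : ℝ → ℂ) ((2 * Real.pi)⁻¹ • ω) := by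
    funext ω
    rw [← angFourierCLM_apply]
    have : angFourierCLM φ ω = FourierTransform.fourier (φ : ℝ → ℂ) (ω * (2 * Real.pi)⁻¹) := rfl
    rw [this, smul_eq_mul, mul_comm]
  have hc : ContDiff ℝ j (FourierTransform.fourier (φ : ℝ → ℂ)) := by
    rw [← SchwartzMap.fourier_coe]; exact SchwartzMap.smooth _ _
  have hi : ∀ n : ℕ, (n : ℕ∞) ≤ (⊤ : ℕ∞) → Integrable (fun x : ℝ => x ^ n • φ x) := by
    intro n _
    refine (φ.integrable_pow_mul volume n).mono'
      (by have := φ.continuous; fun_prop : Continuous _).aestronglyMeasurable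
      (ae_of_all _ fun x => ?_)
    rw [norm_smul, norm_pow]
  simp only [smul_eq_mul] at h0
  rw [h0, iteratedDeriv_comp_const_smul hc, Real.iteratedDeriv_fourier hi le_top]
  simp only [mul_zero]
  rw [Real.fourier_real_eq_integral_exp_smul, ← integral_smul]
  refine integral_congr_ae (ae_of_all _ fun τ => ?_)
  have : (Real.pi : ℂ) ≠ 0 := by exact_mod_cast Real.pi_ne_zero
  simp only [mul_zero, Complex.ofReal_zero, zero_mul, Complex.exp_zero,
    smul_eq_mul, Complex.real_smul]
  push_cast
  rw [one_mul, ← mul_assoc, ← mul_pow]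
  congr 2
  field_simp

/-- Superposition of the Dirac case: $\widehat\varphi$ and its derivatives at $0$ are integrals over
$\tau$ of $e^{-i\omega\tau}$ and its derivatives at $0$, weighted by $\varphi$. -/
theorem adjSymbol_angFourier (φ : 𝓢(ℝ, ℂ)) (ω : ℝ) :
    adjSymbol a b γ k (angFourier φ) ω = ∫ τ, intSymbol a b γ k τ (-ω) * φ τ := by
  have hi : ∀ n : ℕ, Integrable (fun τ : ℝ => (-(Complex.I * τ)) ^ n * φ τ) := by
    intro n
    refine (φ.integrable_pow_mul volume n).mono'
      (by have := φ.continuous; fun_prop : Continuous _).aestronglyMeasurable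
      (ae_of_all _ fun x => ?_)
    simp
  have h1 : ∀ τ, intSymbol a b γ k τ (-ω) * φ τ = (homMult a b γ (-ω))⁻¹ *
      (φ τ * fourierDirac τ ω - ∑ j ∈ Finset.range k,
        ((ω : ℂ) ^ j / (j.factorial : ℂ)) * ((-(Complex.I * τ)) ^ j * φ τ)) := by
    intro τ
    rw [← adjSymbol_fourierDirac, adjSymbol, div_eq_inv_mul, mul_assoc, sub_mul,
      Finset.sum_mul]
    congr 2
    · ring
    · refine Finset.sum_congr rfl fun j _ => ?_
      rw [iteratedDeriv_fourierDirac]; ring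
  simp only [h1]
  rw [integral_const_mul, integral_sub, integral_finsetSum, adjSymbol, div_eq_inv_mul]
  · congr 2
    refine Finset.sum_congr rfl fun j _ => ?_
    rw [integral_const_mul, iteratedDeriv_angFourier]; ring
  · exact fun j _ => (hi j).const_mul _
  · refine φ.integrable.mul_bdd (c := 1) (by unfold fourierDirac; fun_prop)
      (ae_of_all _ fun τ => (norm_fourierDirac _ _).le)
  · exact integrable_finsetSum _ fun j _ => (hi j).const_mul _

theorem integrable_abs_pow_mul (φ : 𝓢(ℝ, ℂ)) (k : ℕ) :
    Integrable (fun τ : ℝ => ((|τ| ^ k : ℝ) : ℂ) * φ τ) := by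
  refine (φ.integrable_pow_mul volume k).mono'
    (by have := φ.continuous; fun_prop : Continuous _).aestronglyMeasurable
    (ae_of_all _ fun x => ?_)
  simp

/-- The adjoint integrator is the adjoint of the integrator. -/
theorem fracIAdj_eq_pairing (hk : γ.re < k + 1) (φ ψ : 𝓢(ℝ, ℂ)) :
    fracIAdj a b γ k φ ψ = pairing (fracI a b γ k ψ) φ := by
  have hp : -1 < k - γ.re := by linarith
  have ht : IsTempered (fun ω : ℝ => ((|ω| ^ (k - γ.re) : ℝ) : ℂ)) :=
    isTempered_of_norm_le (by fun_prop : Measurable _).aestronglyMeasurable hp (C := 1)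
      (ae_of_all _ fun ω => by rw [one_mul, Complex.norm_of_nonneg (by positivity)])
  have hint : Integrable (fun p : ℝ × ℝ => intSymbol a b γ k p.1 (-p.2) * φ p.1 *
      invAngFourierCLM ψ p.2) (volume.prod volume) := by
    -- The symbol bound separates the variables, so the majorant is a product of one-variable
    -- integrable functions.
    have h := ((integrable_abs_pow_mul φ k).mul_prod
      (ht.integrable_mul (invAngFourierCLM ψ))).norm.const_mul (‖a‖⁻¹ + ‖b‖⁻¹)
    refine h.mono' ?_ (ae_of_all _ fun p => ?_)
    · have h1 : Measurable (fun p : ℝ × ℝ => intSymbol a b γ k p.1 (-p.2)) :=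
        (measurable_intSymbol a b γ k).comp (by fun_prop : Measurable fun p : ℝ × ℝ => (p.1, -p.2))
      exact ((h1.mul (φ.continuous.measurable.comp measurable_fst)).mul
        ((invAngFourierCLM ψ).continuous.measurable.comp measurable_snd)).aestronglyMeasurable
    · simp only [norm_mul]
      rw [Complex.norm_of_nonneg (by positivity), Complex.norm_of_nonneg (by positivity)]
      have := norm_intSymbol_le a b γ k p.1 (-p.2)
      rw [abs_neg] at this
      calc _ ≤ (‖a‖⁻¹ + ‖b‖⁻¹) * |p.1| ^ k * |p.2| ^ (k - γ.re) * ‖φ p.1‖ *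
            ‖invAngFourierCLM ψ p.2‖ := by gcongr
        _ = _ := by ring
  have h := integral_integral_swap
    (f := fun τ ω => intSymbol a b γ k τ (-ω) * φ τ * invAngFourierCLM ψ ω) hint
  rw [fracIAdj, pairing]
  simp only [adjSymbol_angFourier, ← invAngFourierCLM_apply, ← integral_mul_const]
  rw [← h]
  refine integral_congr_ae (ae_of_all _ fun τ => ?_)
  simp only
  rw [← integral_intSymbol_neg_mul, ← integral_mul_const]
  refine integral_congr_ae (ae_of_all _ fun ω => ?_)
  simp only; ring

theorem isTempered_adjSymbol_fourierDirac (hk : γ.re < k + 1) (τ : ℝ) :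
    IsTempered (adjSymbol a b γ k (fourierDirac τ)) := by
  have := (isTempered_intSymbol a b γ hk τ).comp_neg
  exact this.mono (funext (adjSymbol_fourierDirac (a := a) (b := b) (γ := γ) (k := k) τ) ▸ this.1)
    (ae_of_all _ fun ω => by rw [adjSymbol_fourierDirac])

theorem isTempered_adjSymbol_angFourier (hk : γ.re < k + 1) (φ : 𝓢(ℝ, ℂ)) :
    IsTempered (adjSymbol a b γ k (angFourier φ)) := by
  have hm : Measurable (fun p : ℝ × ℝ => intSymbol a b γ k p.2 (-p.1) * φ p.2) :=
    ((measurable_intSymbol a b γ k).comp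
      (by fun_prop : Measurable fun p : ℝ × ℝ => (p.2, -p.1))).mul
      (φ.continuous.measurable.comp measurable_snd)
  have hm' : AEStronglyMeasurable (adjSymbol a b γ k (angFourier φ)) := by
    rw [funext (adjSymbol_angFourier (a := a) (b := b) (γ := γ) (k := k) φ)]
    exact hm.stronglyMeasurable.integral_prod_right'.aestronglyMeasurable
  refine isTempered_of_norm_le (p := k - γ.re) (C := (‖a‖⁻¹ + ‖b‖⁻¹) *
    ∫ τ, ‖((|τ| ^ k : ℝ) : ℂ) * φ τ‖) hm' (by linarith) (ae_of_all _ fun ω => ?_)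
  rw [adjSymbol_angFourier, mul_right_comm, ← integral_const_mul]
  refine norm_integral_le_of_norm_le ((integrable_abs_pow_mul φ k).norm.const_mul _)
    (ae_of_all _ fun τ => ?_)
  rw [norm_mul, norm_mul, Complex.norm_of_nonneg (by positivity)]
  have := norm_intSymbol_le a b γ k τ (-ω)
  rw [abs_neg] at this
  calc _ ≤ (‖a‖⁻¹ + ‖b‖⁻¹) * |τ| ^ k * |ω| ^ (k - γ.re) * ‖φ τ‖ := by gcongr
    _ = _ := by ring

theorem ComplexFrac.IsInvFourier.apply_eq_fracI {τ : ℝ} {U : 𝓢'(ℝ, ℂ)}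
    (hU : IsInvFourier (adjSymbol a b γ k (fourierDirac τ)) U) (ψ : 𝓢(ℝ, ℂ)) :
    U ψ = fracI a b γ k ψ τ := by
  rw [(hU ψ).2, ← integral_intSymbol_neg_mul]
  simp only [adjSymbol_fourierDirac, invAngFourierCLM_apply]

end

/-! ### Dirac sequences. -/

/-- A Dirac sequence, integrated against a function that is continuous at its centre. -/
theorem ComplexFrac.IsDeltaSequence.tendsto_integral_mul {τ : ℝ} {φ : ℕ → 𝓢(ℝ, ℂ)}
    (hφ : IsDeltaSequence τ φ) {g : ℝ → ℂ} (hg : ContinuousAt g τ)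
    (hm : AEStronglyMeasurable g) :
    Tendsto (fun n => ∫ t, g t * φ n t) atTop (𝓝 (g τ)) := by
  obtain ⟨hpos, hone, hsupp⟩ := hφ
  rw [Metric.tendsto_atTop']
  intro ε hε
  obtain ⟨r, hr, hgr⟩ := Metric.continuousAt_iff.1 hg (ε / 2) (by linarith)
  obtain ⟨N, hN⟩ := eventually_atTop.1 (hsupp r hr)
  refine ⟨N, fun n hn => ?_⟩
  have hle : ∀ t, ‖(g t - g τ) * φ n t‖ ≤ ε / 2 * ‖φ n t‖ := by
    intro t
    rw [norm_mul]
    by_cases ht : φ n t = 0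
    · simp [ht]
    · have : t ∈ Metric.ball τ r := hN n hn.le (subset_tsupport _ ht)
      gcongr
      have := hgr this
      rw [dist_eq_norm] at this
      exact this.le
  have hi : Integrable (fun t => (g t - g τ) * φ n t) :=
    ((φ n).integrable.norm.const_mul (ε / 2)).mono'
      ((hm.sub aestronglyMeasurable_const).mul (φ n).continuous.aestronglyMeasurable)
      (ae_of_all _ hle)
  have hsplit : ∫ t, g t * φ n t = (∫ t, (g t - g τ) * φ n t) + g τ := by
    have : ∀ t, g t * φ n t = (g t - g τ) * φ n t + g τ * φ n t := fun t => by ring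
    simp only [this]
    rw [integral_add hi ((φ n).integrable.const_mul _), integral_const_mul, hone, mul_one]
  -- Nonnegativity turns unit mass into unit $L^1$ norm.
  have hnorm : ∫ t, ‖φ n t‖ = 1 := by
    have h1 : ∀ t, ((‖φ n t‖ : ℝ) : ℂ) = φ n t := by
      intro t
      obtain ⟨s, hs, h⟩ := hpos n t
      rw [h, Complex.norm_of_nonneg hs]
    have : ((∫ t, ‖φ n t‖ : ℝ) : ℂ) = 1 := by
      rw [← integral_complex_ofReal]
      simp only [h1, hone]
    exact_mod_cast this
  rw [hsplit, dist_eq_norm, add_sub_cancel_right]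
  calc _ ≤ ∫ t, ε / 2 * ‖φ n t‖ :=
        norm_integral_le_of_norm_le ((φ n).integrable.norm.const_mul _) (ae_of_all _ hle)
    _ = ε / 2 := by rw [integral_const_mul, hnorm, mul_one]
    _ < ε := by linarith

/-! ### Boundary values of powers, and kernels away from their singularities. -/

theorem measurable_boundaryPow_right (s : ℂ) (σ ε : ℝ) : Measurable (boundaryPow s σ ε) := by
  unfold boundaryPow; fun_prop

theorem boundaryPow_neg (s : ℂ) (σ ε y : ℝ) :
    boundaryPow s σ ε (-y) = boundaryPow s (-σ) ε y := by
  simp [boundaryPow]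

theorem abs_le_norm_add_I_mul {σ : ℝ} (hσ : |σ| = 1) (ε y : ℝ) :
    |y| ≤ ‖(ε : ℂ) + Complex.I * ((σ * y : ℝ) : ℂ)‖ := by
  have h : ((ε : ℂ) + Complex.I * ((σ * y : ℝ) : ℂ)).im = σ * y := by simp
  have := Complex.abs_im_le_norm ((ε : ℂ) + Complex.I * ((σ * y : ℝ) : ℂ))
  rwa [h, abs_mul, hσ, one_mul] at this

theorem norm_add_I_mul_le {σ : ℝ} (hσ : |σ| = 1) {ε : ℝ} (h0 : 0 ≤ ε) (h1 : ε ≤ 1) (y : ℝ) :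
    ‖(ε : ℂ) + Complex.I * ((σ * y : ℝ) : ℂ)‖ ≤ 1 + |y| := by
  refine (norm_add_le _ _).trans (add_le_add ?_ ?_)
  · rwa [Complex.norm_of_nonneg h0]
  · rw [norm_mul, Complex.norm_I, one_mul, Complex.norm_real, Real.norm_eq_abs, abs_mul, hσ,
      one_mul]

/-- The base has modulus between $|y|$ and $1+|y|$; the two summands cover both signs of
$\operatorname{Re}s$, and the exponential bounds the contribution of the argument. The bound is
uniform in $\varepsilon\in[0,1]$. -/
theorem norm_boundaryPow_le (s : ℂ) {σ : ℝ} (hσ : |σ| = 1) {ε : ℝ} (h0 : 0 ≤ ε) (h1 : ε ≤ 1)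
    {y : ℝ} (hy : y ≠ 0) :
    ‖boundaryPow s σ ε y‖ ≤
      Real.exp (Real.pi * |s.im|) * (|y| ^ s.re + (1 + |y|) ^ s.re) := by
  have hy' : 0 < |y| := abs_pos.2 hy
  set z : ℂ := (ε : ℂ) + Complex.I * ((σ * y : ℝ) : ℂ) with hz
  have hl : |y| ≤ ‖z‖ := abs_le_norm_add_I_mul hσ ε y
  have hu : ‖z‖ ≤ 1 + |y| := norm_add_I_mul_le hσ h0 h1 y
  have hz0 : 0 < ‖z‖ := lt_of_lt_of_le hy' hl
  have e1 : ‖z‖ ^ s.re ≤ |y| ^ s.re + (1 + |y|) ^ s.re := by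
    rcases le_total 0 s.re with h | h
    · have := Real.rpow_le_rpow hz0.le hu h
      have := Real.rpow_nonneg hy'.le s.re
      linarith
    · have := Real.rpow_le_rpow_of_nonpos hy' hl h
      have : 0 ≤ (1 + |y|) ^ s.re := by positivity
      linarith
  have e2 : (Real.exp (Complex.arg z * s.im))⁻¹ ≤ Real.exp (Real.pi * |s.im|) := by
    rw [← Real.exp_neg, Real.exp_le_exp]
    calc _ ≤ |Complex.arg z * s.im| := neg_le_abs _
      _ = |Complex.arg z| * |s.im| := abs_mul _ _
      _ ≤ _ := by gcongr; exact Complex.abs_arg_le_pi z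
  refine (Complex.norm_cpow_le z s).trans ?_
  rw [div_eq_mul_inv, mul_comm]
  gcongr

/-- For $y\ne0$ the base is not real, so it stays off the branch cut even at $\varepsilon=0$. -/
theorem continuousAt_boundaryPow (s : ℂ) {σ : ℝ} (hσ : |σ| = 1) {ε y : ℝ} (hy : y ≠ 0) :
    ContinuousAt (fun q : ℝ × ℝ => boundaryPow s σ q.1 q.2) (ε, y) := by
  unfold boundaryPow
  refine ContinuousAt.cpow (by fun_prop) continuousAt_const ?_
  refine Or.inr ?_
  have hσ0 : σ ≠ 0 := by rintro rfl; simp at hσ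
  simpa using ⟨hσ0, hy⟩

theorem isTempered_abs_rpow {p : ℝ} (hp : -1 < p) :
    IsTempered (fun y : ℝ => ((|y| ^ p : ℝ) : ℂ)) :=
  isTempered_of_norm_le (by fun_prop : Measurable _).aestronglyMeasurable hp (C := 1)
    (ae_of_all _ fun ω => by rw [one_mul, Complex.norm_of_nonneg (by positivity)])

theorem isTempered_one_add_abs_rpow (p : ℝ) :
    IsTempered (fun y : ℝ => (((1 + |y|) ^ p : ℝ) : ℂ)) :=
  isTempered_of_norm_le_one_add (by fun_prop : Measurable _).aestronglyMeasurable (p := p) (C := 1)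
    (ae_of_all _ fun ω => by rw [one_mul, Complex.norm_of_nonneg (by positivity)])

theorem ae_sub_ne_zero (x : ℝ) : ∀ᵐ y : ℝ, y - x ≠ 0 := by
  filter_upwards [Measure.ae_ne volume x] with y hy
  exact sub_ne_zero.2 hy

theorem isTempered_boundaryPow {s : ℂ} (hs : -1 < s.re) {σ : ℝ} (hσ : |σ| = 1) :
    IsTempered (boundaryPow s σ 0) := by
  refine (((isTempered_abs_rpow hs).add (isTempered_one_add_abs_rpow s.re)).const_mul
    (Real.exp (Real.pi * |s.im|) : ℂ)).mono
    (measurable_boundaryPow_right s σ 0).aestronglyMeasurable ?_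
  filter_upwards [ae_sub_ne_zero 0] with y hy
  rw [sub_zero] at hy
  refine (norm_boundaryPow_le s hσ le_rfl zero_le_one hy).trans (le_of_eq ?_)
  rw [← Complex.ofReal_add, ← Complex.ofReal_mul,
    Complex.norm_of_nonneg (by positivity)]

/-- Near the support of a test function, or for an exponent above `-1`, the boundary powers have a
common integrable majorant. -/
theorem exists_isTempered_boundaryPow_le (s : ℂ) {σ : ℝ} (hσ : |σ| = 1) (φ : 𝓢(ℝ, ℂ)) (x : ℝ)
    (h : -1 < s.re ∨ x ∉ tsupport φ) :
    ∃ g : ℝ → ℂ, IsTempered g ∧ ∀ ε : ℝ, 0 ≤ ε → ε ≤ 1 → ∀ᵐ τ : ℝ,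
      ‖boundaryPow s σ ε (τ - x) * φ τ‖ ≤ ‖g τ * φ τ‖ := by
  rcases h with hs | hx
  · refine ⟨_, (((isTempered_abs_rpow hs).add (isTempered_one_add_abs_rpow s.re)).const_mul
      (Real.exp (Real.pi * |s.im|) : ℂ)).comp_sub_right x, fun ε h0 h1 => ?_⟩
    filter_upwards [ae_sub_ne_zero x] with y hy
    rw [norm_mul, norm_mul]
    refine mul_le_mul_of_nonneg_right ?_ (norm_nonneg _)
    refine (norm_boundaryPow_le s hσ h0 h1 hy).trans (le_of_eq ?_)
    rw [← Complex.ofReal_add, ← Complex.ofReal_mul,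
      Complex.norm_of_nonneg (by positivity)]
  · obtain ⟨δ, hδ, hball⟩ := Metric.isOpen_iff.1 (isClosed_tsupport φ).isOpen_compl x hx
    -- The gap $\delta$ between $x$ and the support tames any exponent. The factor $2$ collects
    -- $(1+|y-x|)^{\operatorname{Re}s}$ from `norm_boundaryPow_le` and again from `hb`.
    refine ⟨_, (((isTempered_one_add_abs_rpow 0).const_mul ((δ ^ s.re : ℝ) : ℂ)).add
      ((isTempered_one_add_abs_rpow s.re).const_mul 2)).const_mul
      (Real.exp (Real.pi * |s.im|) : ℂ) |>.comp_sub_right x, fun ε h0 h1 => ?_⟩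
    filter_upwards [ae_sub_ne_zero x] with y hy
    by_cases hφ : φ y = 0
    · simp [hφ]
    have hyδ : δ ≤ |y - x| := by
      by_contra hlt
      exact hball (show y ∈ Metric.ball x δ by rwa [Metric.mem_ball, Real.dist_eq, ← not_le])
        (subset_tsupport _ hφ)
    have hb : |y - x| ^ s.re ≤ δ ^ s.re + (1 + |y - x|) ^ s.re := by
      rcases le_total 0 s.re with h | h
      · have := Real.rpow_le_rpow (abs_nonneg _) (by linarith : |y - x| ≤ 1 + |y - x|) h
        have := Real.rpow_nonneg hδ.le s.re
        linarith
      · have := Real.rpow_le_rpow_of_nonpos hδ hyδ h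
        have : 0 ≤ (1 + |y - x|) ^ s.re := by positivity
        linarith
    rw [norm_mul, norm_mul]
    refine mul_le_mul_of_nonneg_right ?_ (norm_nonneg _)
    refine (norm_boundaryPow_le s hσ h0 h1 hy).trans ?_
    rw [Real.rpow_zero, ← Complex.ofReal_mul, ← Complex.ofReal_ofNat, ← Complex.ofReal_mul,
      ← Complex.ofReal_add, ← Complex.ofReal_mul,
      Complex.norm_of_nonneg (by positivity)]
    refine mul_le_mul_of_nonneg_left ?_ (Real.exp_nonneg _)
    have : 0 ≤ (1 + |y - x|) ^ s.re := by positivity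
    linarith

/-- The functions `F ε` are integrable for small `ε ≥ 0` and their integrals tend to that of
`F 0`. -/
def HasIntegralLimit (F : ℝ → ℝ → ℂ) : Prop :=
  Integrable (F 0) ∧ (∀ᶠ ε in 𝓝[>] 0, Integrable (F ε)) ∧
    Tendsto (fun ε => ∫ τ, F ε τ) (𝓝[>] 0) (𝓝 (∫ τ, F 0 τ))

namespace HasIntegralLimit

variable {F G : ℝ → ℝ → ℂ}

theorem add (hF : HasIntegralLimit F) (hG : HasIntegralLimit G) :
    HasIntegralLimit (fun ε τ => F ε τ + G ε τ) := by
  refine ⟨hF.1.add hG.1, ?_, ?_⟩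
  · filter_upwards [hF.2.1, hG.2.1] with ε h1 h2 using h1.add h2
  · rw [integral_add hF.1 hG.1]
    refine (hF.2.2.add hG.2.2).congr' ?_
    filter_upwards [hF.2.1, hG.2.1] with ε h1 h2
    rw [integral_add h1 h2]

theorem const_mul (hF : HasIntegralLimit F) (c : ℂ) :
    HasIntegralLimit (fun ε τ => c * F ε τ) := by
  refine ⟨hF.1.const_mul c, ?_, ?_⟩
  · filter_upwards [hF.2.1] with ε h1 using h1.const_mul c
  · simp only [integral_const_mul]
    exact hF.2.2.const_mul c

theorem finset_sum {ι : Type*} (s : Finset ι) {F : ι → ℝ → ℝ → ℂ}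
    (h : ∀ i ∈ s, HasIntegralLimit (F i)) :
    HasIntegralLimit (fun ε τ => ∑ i ∈ s, F i ε τ) := by
  classical
  induction s using Finset.induction_on with
  | empty => simp [HasIntegralLimit]
  | insert i s hi ih =>
    simp only [Finset.sum_insert hi]
    exact (h i (by simp)).add (ih fun j hj => h j (by simp [hj]))

end HasIntegralLimit

theorem hasIntegralLimit_boundaryPow (s : ℂ) {σ : ℝ} (hσ : |σ| = 1) (φ : 𝓢(ℝ, ℂ)) (x : ℝ)
    (h : -1 < s.re ∨ x ∉ tsupport φ) :
    HasIntegralLimit (fun ε τ => boundaryPow s σ ε (τ - x) * φ τ) := by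
  obtain ⟨g, hg, hle⟩ := exists_isTempered_boundaryPow_le s hσ φ x h
  have hm : ∀ ε, AEStronglyMeasurable (fun τ => boundaryPow s σ ε (τ - x) * φ τ) := fun ε =>
    (((measurable_boundaryPow_right s σ ε).comp (measurable_id.sub_const x)).mul
      φ.continuous.measurable).aestronglyMeasurable
  have hev : ∀ᶠ ε : ℝ in 𝓝[>] 0, 0 ≤ ε ∧ ε ≤ 1 := by
    filter_upwards [Ioc_mem_nhdsGT (zero_lt_one' ℝ)] with ε hε using ⟨hε.1.le, hε.2⟩
  refine ⟨(hg.integrable_mul φ).norm.mono' (hm 0) (hle 0 le_rfl zero_le_one), ?_, ?_⟩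
  · filter_upwards [hev] with ε hε
    exact (hg.integrable_mul φ).norm.mono' (hm ε) (hle ε hε.1 hε.2)
  · refine tendsto_integral_filter_of_dominated_convergence _ (Eventually.of_forall hm) ?_
      (hg.integrable_mul φ).norm ?_
    · filter_upwards [hev] with ε hε using hle ε hε.1 hε.2
    · filter_upwards [ae_sub_ne_zero x] with τ hτ
      have h1 := (continuousAt_boundaryPow s hσ (ε := 0) hτ).comp
        (f := fun ε : ℝ => (ε, τ - x)) (x := 0) (by fun_prop)
      exact (h1.tendsto.mono_left nhdsWithin_le_nhds).mul_const _

/-- The leading power is singular at $\tau=x$ with exponent $\gamma-1$. The corrections are singular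
at $\tau=0$ with exponents $\gamma-1-j$, possibly not locally integrable, hence the alternative on
$0$. -/
theorem hasIntegralLimit_halfKernel (γ : ℂ) (k : ℕ) {σ : ℝ} (hσ : |σ| = 1) (φ : 𝓢(ℝ, ℂ)) (x : ℝ)
    (h : 0 < γ.re ∨ x ∉ tsupport φ) (h0 : k = 0 ∨ (0 : ℝ) ∉ tsupport φ) :
    HasIntegralLimit (fun ε τ => halfKernel γ k σ ε x τ * φ τ) := by
  have h1 : -1 < (γ - 1).re ∨ x ∉ tsupport φ := h.imp_left fun h => by simpa using h
  have h2 : HasIntegralLimit (fun ε τ => ∑ j ∈ Finset.range k,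
      -(genBinom (j - γ) j * (Complex.I * ((σ * x : ℝ) : ℂ)) ^ j) *
        (boundaryPow (γ - 1 - j) σ ε (τ - 0) * φ τ)) := by
    refine HasIntegralLimit.finset_sum _ fun j hj => HasIntegralLimit.const_mul ?_ _
    refine hasIntegralLimit_boundaryPow _ hσ φ 0 (Or.inr (h0.resolve_left ?_))
    rintro rfl; simp at hj
  convert (hasIntegralLimit_boundaryPow _ hσ φ x h1).add h2 using 3 with ε τ
  rw [halfKernel, sub_mul, Finset.sum_mul, sub_eq_add_neg, ← Finset.sum_neg_distrib]
  congr 1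
  refine Finset.sum_congr rfl fun j _ => ?_
  rw [sub_zero]; ring

theorem hasIntegralLimit_kernelIReg (a b : ℂ) {γ : ℂ} (hγ : ∀ n : ℤ, γ ≠ (n : ℂ)) (k : ℕ)
    (φ : 𝓢(ℝ, ℂ)) (x : ℝ) (h : 0 < γ.re ∨ x ∉ tsupport φ)
    (h0 : k = 0 ∨ (0 : ℝ) ∉ tsupport φ) :
    HasIntegralLimit (fun ε τ => kernelIReg a b γ k ε x τ * φ τ) := by
  have h1 := hasIntegralLimit_halfKernel γ k (σ := 1) (by simp) φ x h h0
  have h2 := hasIntegralLimit_halfKernel γ k (σ := -1) (by simp) φ x h h0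
  convert ((h1.const_mul a⁻¹).add (h2.const_mul b⁻¹)).const_mul
    (Complex.Gamma (1 - γ) / (2 * Real.pi)) using 3 with ε τ
  rw [kernelIReg_eq a b hγ]; ring

/-- Away from the singularities the integrator is given by its kernel. -/
theorem fracI_eq_integral_kernelI (a b : ℂ) {γ : ℂ} (hγ : ∀ n : ℤ, γ ≠ (n : ℂ)) {k : ℕ}
    (hk : γ.re < k + 1) (φ : 𝓢(ℝ, ℂ)) (x : ℝ) (h : 0 < γ.re ∨ x ∉ tsupport φ)
    (h0 : k = 0 ∨ (0 : ℝ) ∉ tsupport φ) :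
    Integrable (fun τ => kernelI a b γ k x τ * φ τ) ∧
      fracI a b γ k φ x = ∫ τ, kernelI a b γ k x τ * φ τ := by
  have hγ1 : γ ≠ 1 := by simpa using hγ 1
  simp only [kernelI_eq_kernelIReg a b hγ1]
  have hl := hasIntegralLimit_kernelIReg a b hγ k φ x h h0
  -- The same regularized integrals converge to the operator on the Fourier side and to the kernel
  -- integral on the space side.
  exact ⟨hl.1, tendsto_nhds_unique (tendsto_integral_kernelIReg_mul hγ hk φ x) hl.2.2⟩

/-! ### The integrator's kernel in both variables: continuity and Fubini. -/

theorem measurable_kernelIReg (a b γ : ℂ) (k : ℕ) (ε : ℝ) :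
    Measurable (fun q : ℝ × ℝ => kernelIReg a b γ k ε q.1 q.2) := by
  unfold kernelIReg; fun_prop

theorem measurable_kernelI (a b γ : ℂ) (k : ℕ) :
    Measurable (fun q : ℝ × ℝ => kernelI a b γ k q.1 q.2) := by
  unfold kernelI; fun_prop

theorem isTempered_pow (j : ℕ) (c : ℂ) : IsTempered (fun x : ℝ => (c * x) ^ j) := by
  refine isTempered_of_norm_le_one_add (by fun_prop : Continuous _).aestronglyMeasurable (p := j)
    (C := ‖c‖ ^ j) (ae_of_all _ fun x => ?_)
  rw [norm_pow, norm_mul, mul_pow, Complex.norm_real, Real.rpow_natCast, Real.norm_eq_abs]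
  gcongr
  linarith

/-- As functions of $x$ the corrections are polynomials, and the leading power is locally integrable
since $\operatorname{Re}\gamma-1>-1$. -/
theorem isTempered_halfKernel_left {γ : ℂ} (hγ0 : 0 < γ.re) (k : ℕ) {σ : ℝ} (hσ : |σ| = 1)
    (τ : ℝ) : IsTempered (fun x => halfKernel γ k σ 0 x τ) := by
  have h1 : IsTempered (fun x => boundaryPow (γ - 1) (-σ) 0 (x - τ)) :=
    (isTempered_boundaryPow (by simpa using hγ0) (by rwa [abs_neg])).comp_sub_right τ
  have h2 : IsTempered (fun x => ∑ j ∈ Finset.range k,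
      -(genBinom (j - γ) j * boundaryPow (γ - 1 - j) σ 0 τ) * ((Complex.I * σ) * x) ^ j) :=
    IsTempered.finset_sum _ fun j _ => (isTempered_pow j _).const_mul _
  convert h1.add h2 using 2 with x
  rw [halfKernel, ← boundaryPow_neg, neg_sub, sub_eq_add_neg, ← Finset.sum_neg_distrib]
  congr 1
  refine Finset.sum_congr rfl fun j _ => ?_
  push_cast; ring

theorem isTempered_kernelI_left (a b : ℂ) {γ : ℂ} (hγ : ∀ n : ℤ, γ ≠ (n : ℂ)) (hγ0 : 0 < γ.re)
    (k : ℕ) (τ : ℝ) : IsTempered (fun x => kernelI a b γ k x τ) := by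
  have hγ1 : γ ≠ 1 := by simpa using hγ 1
  have h1 := isTempered_halfKernel_left hγ0 k (σ := 1) (by simp) τ
  have h2 := isTempered_halfKernel_left hγ0 k (σ := -1) (by simp) τ
  convert ((h1.const_mul a⁻¹).add (h2.const_mul b⁻¹)).const_mul
    (Complex.Gamma (1 - γ) / (2 * Real.pi)) using 2 with x
  rw [kernelI_eq_kernelIReg a b hγ1, kernelIReg_eq a b hγ]; ring

/-- The convolution of a tempered function with a Schwartz function is continuous. -/
theorem IsTempered.continuous_integral_mul_comp_sub {g : ℝ → ℂ} (hg : IsTempered g)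
    (ψ : 𝓢(ℝ, ℂ)) : Continuous (fun t : ℝ => ∫ x, g (t - x) * ψ x) := by
  have h1 : ∀ t : ℝ, ∫ x, g (t - x) * ψ x = ∫ y, g y * ψ (t - y) := by
    intro t
    rw [← integral_sub_left_eq_self _ volume t]
    simp only [sub_sub_cancel]
  simp only [h1]
  obtain ⟨N, hN⟩ := hg.2
  obtain ⟨C, hC, hψ⟩ := ψ.exists_norm_le_one_add_abs_rpow N
  refine continuous_iff_continuousAt.2 fun t₀ => ?_
  refine continuousAt_of_dominated (bound := fun y =>
    C * (2 + |t₀|) ^ (N : ℝ) * (‖g y‖ * (1 + |y|) ^ (-(N : ℝ)))) ?_ ?_ (hN.const_mul _) ?_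
  · refine Eventually.of_forall fun t => hg.1.mul ?_
    exact (ψ.continuous.comp (by fun_prop)).aestronglyMeasurable
  · filter_upwards [Metric.ball_mem_nhds t₀ one_pos] with t ht
    refine ae_of_all _ fun y => ?_
    have ht' : |t| ≤ |t₀| + 1 := by
      rw [Metric.mem_ball, Real.dist_eq] at ht
      have := abs_sub_abs_le_abs_sub t t₀
      linarith
    have hy : 1 + |y| ≤ (2 + |t₀|) * (1 + |t - y|) := by
      have h2 : |y| ≤ |t| + |t - y| := by
        have := abs_sub t (t - y)
        rwa [sub_sub_cancel] at this
      nlinarith [abs_nonneg t₀, abs_nonneg (t - y)]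
    have hpow : (1 + |t - y|) ^ (-(N : ℝ)) ≤ (2 + |t₀|) ^ (N : ℝ) * (1 + |y|) ^ (-(N : ℝ)) := by
      rw [Real.rpow_neg (by positivity), Real.rpow_neg (by positivity), ← div_eq_mul_inv,
        le_div_iff₀ (by positivity), inv_mul_le_iff₀ (by positivity), mul_comm,
        ← Real.mul_rpow (by positivity) (by positivity)]
      exact Real.rpow_le_rpow (by positivity) hy (by positivity)
    rw [norm_mul]
    calc _ ≤ ‖g y‖ * (C * ((2 + |t₀|) ^ (N : ℝ) * (1 + |y|) ^ (-(N : ℝ)))) := by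
          gcongr; exact (hψ _).trans (by gcongr)
      _ = _ := by ring
  · exact ae_of_all _ fun y =>
      (continuous_const.mul (ψ.continuous.comp (by fun_prop))).continuousAt

/-- The leading term is a convolution with $\psi$, continuous everywhere; the corrections are
moments of $\psi$ times powers of $\pm it$, continuous off $0$. -/
theorem continuousAt_integral_halfKernel {γ : ℂ} (hγ0 : 0 < γ.re) (k : ℕ) {σ : ℝ} (hσ : |σ| = 1)
    (ψ : 𝓢(ℝ, ℂ)) {τ : ℝ} (hτ : τ ≠ 0) :
    ContinuousAt (fun t => ∫ x, halfKernel γ k σ 0 x t * ψ x) τ := by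
  have hb : IsTempered (boundaryPow (γ - 1) σ 0) :=
    isTempered_boundaryPow (by simpa using hγ0) hσ
  have hb' : ∀ t, Integrable (fun x => boundaryPow (γ - 1) σ 0 (t - x) * ψ x) := fun t => by
    have := ((isTempered_boundaryPow (s := γ - 1) (by simpa using hγ0)
      (by rwa [abs_neg] : |-σ| = 1)).comp_sub_right t).integrable_mul ψ
    simpa only [← boundaryPow_neg, neg_sub] using this
  have hp : ∀ j : ℕ, Integrable (fun x : ℝ => ((Complex.I * σ) * x) ^ j * ψ x) := fun j =>
    (isTempered_pow j _).integrable_mul ψ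
  have hsplit : ∀ t, ∫ x, halfKernel γ k σ 0 x t * ψ x =
      (∫ x, boundaryPow (γ - 1) σ 0 (t - x) * ψ x) - ∑ j ∈ Finset.range k,
        genBinom (j - γ) j * boundaryPow (γ - 1 - j) σ 0 t *
          ∫ x : ℝ, ((Complex.I * σ) * x) ^ j * ψ x := by
    intro t
    have e : ∀ x, halfKernel γ k σ 0 x t * ψ x = boundaryPow (γ - 1) σ 0 (t - x) * ψ x -
        ∑ j ∈ Finset.range k, genBinom (j - γ) j * boundaryPow (γ - 1 - j) σ 0 t *
          (((Complex.I * σ) * x) ^ j * ψ x) := by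
      intro x
      rw [halfKernel, sub_mul, Finset.sum_mul]
      congr 1
      refine Finset.sum_congr rfl fun j _ => ?_
      push_cast; ring
    simp only [e]
    rw [integral_sub (hb' t) (integrable_finsetSum _ fun j _ => (hp j).const_mul _),
      integral_finsetSum _ fun j _ => (hp j).const_mul _]
    simp only [integral_const_mul]
  rw [funext hsplit]
  refine (hb.continuous_integral_mul_comp_sub ψ).continuousAt.sub ?_
  refine tendsto_finsetSum _ fun j _ => ?_
  have := (continuousAt_boundaryPow (γ - 1 - j) hσ (ε := 0) hτ).comp
    (f := fun t : ℝ => ((0 : ℝ), t)) (x := τ) (by fun_prop)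
  exact (this.tendsto.const_mul _).mul_const _

theorem continuousAt_integral_kernelI (a b : ℂ) {γ : ℂ} (hγ : ∀ n : ℤ, γ ≠ (n : ℂ))
    (hγ0 : 0 < γ.re) (k : ℕ) (ψ : 𝓢(ℝ, ℂ)) {τ : ℝ} (hτ : τ ≠ 0) :
    ContinuousAt (fun t => ∫ x, kernelI a b γ k x t * ψ x) τ := by
  have hγ1 : γ ≠ 1 := by simpa using hγ 1
  have e : ∀ t, ∫ x, kernelI a b γ k x t * ψ x = Complex.Gamma (1 - γ) / (2 * Real.pi) *
      (a⁻¹ * (∫ x, halfKernel γ k 1 0 x t * ψ x) +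
        b⁻¹ * ∫ x, halfKernel γ k (-1) 0 x t * ψ x) := by
    intro t
    have h1 := (isTempered_halfKernel_left hγ0 k (σ := 1) (by simp) t).integrable_mul ψ
    have h2 := (isTempered_halfKernel_left hγ0 k (σ := -1) (by simp) t).integrable_mul ψ
    rw [← integral_const_mul, ← integral_const_mul,
      ← integral_add (h1.const_mul _) (h2.const_mul _), ← integral_const_mul]
    refine integral_congr_ae (ae_of_all _ fun x => ?_)
    simp only [kernelI_eq_kernelIReg a b hγ1, kernelIReg_eq a b hγ]
    ring
  rw [funext e]
  exact ((continuousAt_integral_halfKernel hγ0 k (by simp) ψ hτ).const_mul _ |>.add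
    ((continuousAt_integral_halfKernel hγ0 k (by simp) ψ hτ).const_mul _)).const_mul _

/-- Near the diagonal the power is dominated by a multiple of an integrable convolution kernel plus
a smooth weight; away from it, polynomial growth is absorbed by the Schwartz factors. -/
theorem integrable_prod_boundaryPow_sub {s : ℂ} (hs : -1 < s.re) {σ : ℝ} (hσ : |σ| = 1)
    (φ ψ : 𝓢(ℝ, ℂ)) :
    Integrable (fun q : ℝ × ℝ => boundaryPow s σ 0 (q.1 - q.2) * (φ q.1 * ψ q.2))
      (volume.prod volume) := by
  obtain ⟨n, hn⟩ := exists_nat_ge |s.re|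
  obtain ⟨C, hC, hφ⟩ := φ.exists_norm_le_one_add_abs_rpow 0
  set g : ℝ → ℂ := (Set.Ioo (-1) 1).indicator (fun y => ((|y| ^ s.re : ℝ) : ℂ)) with hg
  have hgi : Integrable g := by
    -- Since $n\ge|\operatorname{Re}s|$, the total exponent $\operatorname{Re}s-n-2$ is below $-1$;
    -- the factor $2^{n+2}$ compensates $(1+|y|)^{-n-2}$ on $|y|<1$.
    refine (integrable_abs_rpow_mul_one_add_abs_rpow (q := -(n : ℝ) - 2) hs ?_).const_mul
      ((2 : ℝ) ^ ((n : ℝ) + 2)) |>.mono' ?_ (ae_of_all _ fun y => ?_)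
    · linarith [le_abs_self s.re]
    · exact ((by fun_prop : Measurable fun y : ℝ => ((|y| ^ s.re : ℝ) : ℂ)).indicator
        measurableSet_Ioo).aestronglyMeasurable
    · rw [hg]
      by_cases hy : y ∈ Set.Ioo (-1 : ℝ) 1
      · rw [Set.indicator_of_mem hy, Complex.norm_of_nonneg (by positivity), mul_left_comm]
        refine le_mul_of_one_le_right (by positivity) ?_
        rw [show -(n : ℝ) - 2 = -((n : ℝ) + 2) by ring, Real.rpow_neg (by positivity),
          ← div_eq_mul_inv, one_le_div (by positivity)]
        refine Real.rpow_le_rpow (by positivity) ?_ (by positivity)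
        have := abs_lt.2 hy
        linarith
      · rw [Set.indicator_of_notMem hy, norm_zero]; positivity
  have h1 : Integrable (fun q : ℝ × ℝ => φ q.1 * (ψ q.2 * g (q.1 - q.2)))
      (volume.prod volume) := by
    have := Integrable.convolution_integrand (ContinuousLinearMap.mul ℝ ℂ) (ψ.integrable (μ := volume)) hgi
    refine this.bdd_mul (c := C) (φ.continuous.comp continuous_fst).aestronglyMeasurable
      (ae_of_all _ fun q => ?_)
    simpa using hφ q.1
  have h2 : ∀ φ : 𝓢(ℝ, ℂ), Integrable (fun t : ℝ => (((1 + |t|) ^ (n : ℝ) : ℝ) : ℂ) * φ t) :=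
    fun φ => (isTempered_one_add_abs_rpow n).integrable_mul φ
  have h3 := (h2 φ).mul_prod (h2 ψ)
  have hne : ∀ᵐ q : ℝ × ℝ ∂(volume.prod volume), q.1 - q.2 ≠ 0 := by
    have hms : MeasurableSet {q : ℝ × ℝ | q.1 - q.2 ≠ 0} :=
      (isOpen_ne_fun (by fun_prop) continuous_const).measurableSet
    refine (Measure.ae_prod_iff_ae_ae hms).2 (ae_of_all _ fun x => ?_)
    filter_upwards [ae_sub_ne_zero x] with y hy
    rwa [← neg_sub, neg_ne_zero]
  refine ((h1.norm.add (h3.norm.const_mul 2)).const_mul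
    (Real.exp (Real.pi * |s.im|))).mono' ?_ ?_
  · exact (((measurable_boundaryPow_right s σ 0).comp (measurable_fst.sub measurable_snd)).mul
      ((φ.continuous.measurable.comp measurable_fst).mul
        (ψ.continuous.measurable.comp measurable_snd))).aestronglyMeasurable
  · filter_upwards [hne] with q hq
    have hb := norm_boundaryPow_le s hσ le_rfl zero_le_one hq
    have hA : ∀ u : ℝ, 1 ≤ u → u ^ s.re ≤ u ^ (n : ℝ) := fun u hu =>
      Real.rpow_le_rpow_of_exponent_le hu ((le_abs_self _).trans hn)
    have hpow : (1 + |q.1 - q.2|) ^ (n : ℝ) ≤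
        (1 + |q.1|) ^ (n : ℝ) * (1 + |q.2|) ^ (n : ℝ) := by
      rw [← Real.mul_rpow (by positivity) (by positivity)]
      refine Real.rpow_le_rpow (by positivity) ?_ (by positivity)
      nlinarith [abs_sub q.1 q.2, abs_nonneg q.1, abs_nonneg q.2]
    have h1' : (1 + |q.1 - q.2|) ^ s.re ≤ (1 + |q.1|) ^ (n : ℝ) * (1 + |q.2|) ^ (n : ℝ) :=
      (hA _ (by linarith [abs_nonneg (q.1 - q.2)])).trans hpow
    have h2' : |q.1 - q.2| ^ s.re ≤
        ‖g (q.1 - q.2)‖ + (1 + |q.1|) ^ (n : ℝ) * (1 + |q.2|) ^ (n : ℝ) := by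
      by_cases hy : q.1 - q.2 ∈ Set.Ioo (-1 : ℝ) 1
      · rw [hg, Set.indicator_of_mem hy, Complex.norm_of_nonneg (by positivity)]
        have : 0 ≤ (1 + |q.1|) ^ (n : ℝ) * (1 + |q.2|) ^ (n : ℝ) := by positivity
        linarith
      · have h1 : 1 ≤ |q.1 - q.2| := by
          by_contra hlt
          exact hy (abs_lt.1 (not_le.1 hlt))
        have := (hA _ h1).trans ((Real.rpow_le_rpow (abs_nonneg _)
          (by linarith : |q.1 - q.2| ≤ 1 + |q.1 - q.2|) (by positivity)).trans hpow)
        have := norm_nonneg (g (q.1 - q.2))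
        linarith
    simp only [norm_mul, Pi.add_apply]
    rw [Complex.norm_of_nonneg (by positivity : 0 ≤ (1 + |q.1|) ^ (n : ℝ)),
      Complex.norm_of_nonneg (by positivity : 0 ≤ (1 + |q.2|) ^ (n : ℝ))]
    calc _ ≤ Real.exp (Real.pi * |s.im|) * ((‖g (q.1 - q.2)‖ +
            (1 + |q.1|) ^ (n : ℝ) * (1 + |q.2|) ^ (n : ℝ)) +
            (1 + |q.1|) ^ (n : ℝ) * (1 + |q.2|) ^ (n : ℝ)) * (‖φ q.1‖ * ‖ψ q.2‖) := by
          gcongr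
          exact hb.trans (by gcongr)
      _ = _ := by ring

theorem integrable_prod_halfKernel {γ : ℂ} (hγ0 : 0 < γ.re) (k : ℕ) {σ : ℝ} (hσ : |σ| = 1)
    (φ ψ : 𝓢(ℝ, ℂ)) (h0 : (0 : ℝ) ∉ tsupport φ) :
    Integrable (fun q : ℝ × ℝ => halfKernel γ k σ 0 q.2 q.1 * (φ q.1 * ψ q.2))
      (volume.prod volume) := by
  have h1 := integrable_prod_boundaryPow_sub (s := γ - 1) (by simpa using hγ0) hσ φ ψ
  have h2 : ∀ j : ℕ, Integrable (fun q : ℝ × ℝ => (boundaryPow (γ - 1 - j) σ 0 (q.1 - 0) * φ q.1) *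
      (((Complex.I * σ) * q.2) ^ j * ψ q.2)) (volume.prod volume) := fun j =>
    (hasIntegralLimit_boundaryPow _ hσ φ 0 (Or.inr h0)).1.mul_prod
      ((isTempered_pow j _).integrable_mul ψ)
  have h3 := h1.sub (integrable_finsetSum (Finset.range k) fun j _ =>
    (h2 j).const_mul (genBinom (j - γ) j))
  refine h3.congr (ae_of_all _ fun q => ?_)
  simp only [Pi.sub_apply, sub_zero]
  rw [halfKernel, sub_mul, Finset.sum_mul]
  congr 1
  refine Finset.sum_congr rfl fun j _ => ?_
  push_cast; ring

theorem integrable_prod_kernelI (a b : ℂ) {γ : ℂ} (hγ : ∀ n : ℤ, γ ≠ (n : ℂ)) (hγ0 : 0 < γ.re)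
    (k : ℕ) (φ ψ : 𝓢(ℝ, ℂ)) (h0 : (0 : ℝ) ∉ tsupport φ) :
    Integrable (fun q : ℝ × ℝ => kernelI a b γ k q.2 q.1 * φ q.1 * ψ q.2)
      (volume.prod volume) := by
  have hγ1 : γ ≠ 1 := by simpa using hγ 1
  have h1 := integrable_prod_halfKernel hγ0 k (σ := 1) (by simp) φ ψ h0
  have h2 := integrable_prod_halfKernel hγ0 k (σ := -1) (by simp) φ ψ h0
  refine (((h1.const_mul a⁻¹).add (h2.const_mul b⁻¹)).const_mul
    (Complex.Gamma (1 - γ) / (2 * Real.pi))).congr (ae_of_all _ fun q => ?_)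
  simp only [Pi.add_apply]
  rw [kernelI_eq_kernelIReg a b hγ1, kernelIReg_eq a b hγ]; ring

/-! ### Impulse responses of the integrator and of its adjoint. -/

section

variable {a b γ : ℂ} {k : ℕ}

/-- Exchange of the integrations against the kernel of the integrator. -/
theorem integral_integral_kernelI (hγ : ∀ n : ℤ, γ ≠ (n : ℂ)) (hγ0 : 0 < γ.re)
    (φ ψ : 𝓢(ℝ, ℂ)) (h0 : (0 : ℝ) ∉ tsupport φ) :
    ∫ t, (∫ x, kernelI a b γ k x t * ψ x) * φ t = ∫ x, (∫ t, kernelI a b γ k x t * φ t) * ψ x := by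
  have h := integral_integral_swap (f := fun t x => kernelI a b γ k x t * φ t * ψ x)
    (integrable_prod_kernelI a b hγ hγ0 k φ ψ h0)
  simp only [← integral_mul_const]
  rw [← h]
  refine integral_congr_ae (ae_of_all _ fun t => integral_congr_ae (ae_of_all _ fun x => ?_))
  simp only; ring

/-- Once the supports avoid $0$, Fubini turns the pairing into $\int\big(\int K_{\mathrm
I}(x,t)\psi(x)dx\big)\varphi_n(t)dt$, and the inner function is continuous at $\tau$. -/
theorem exists_impulseResponse_fracI (hγ : ∀ n : ℤ, γ ≠ (n : ℂ)) (hγ0 : 0 < γ.re)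
    (hk : γ.re < k + 1) {τ : ℝ} (hτ : τ ≠ 0) : ∃ U : 𝓢'(ℝ, ℂ),
      IsImpulseResponse (fun φ ψ => pairing (fracI a b γ k φ) ψ) τ U ∧
      AgreesOn U (fun x => kernelI a b γ k x τ) Set.univ := by
  obtain ⟨U, hU, hA⟩ := (isTempered_kernelI_left a b hγ hγ0 k τ).exists_agreesOn
  refine ⟨U, fun φ hφ ψ => ?_, hA⟩
  rw [hU]
  have hm : AEStronglyMeasurable (fun t => ∫ x, kernelI a b γ k x t * ψ x) := by
    have : Measurable (fun q : ℝ × ℝ => kernelI a b γ k q.2 q.1 * ψ q.2) :=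
      ((measurable_kernelI a b γ k).comp measurable_swap).mul
        (ψ.continuous.measurable.comp measurable_snd)
    exact this.stronglyMeasurable.integral_prod_right'.aestronglyMeasurable
  refine (hφ.tendsto_integral_mul (continuousAt_integral_kernelI a b hγ hγ0 k ψ hτ) hm).congr' ?_
  -- The open ball of radius $|\tau|$ about $\tau$ misses $0$.
  filter_upwards [hφ.2.2 |τ| (abs_pos.2 hτ)] with n hn
  have h0 : (0 : ℝ) ∉ tsupport (φ n) := fun h => by
    have := hn h
    simp [Real.dist_eq] at this
  rw [integral_integral_kernelI hγ hγ0 (φ n) ψ h0, pairing]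
  refine integral_congr_ae (ae_of_all _ fun x => ?_)
  simp only
  rw [(fracI_eq_integral_kernelI a b hγ hk (φ n) x (Or.inl hγ0) (Or.inr h0)).2]

theorem isImpulseResponse_fracIAdj (hk : γ.re < k + 1) {τ : ℝ} {U : 𝓢'(ℝ, ℂ)}
    (hU : ∀ ψ, U ψ = fracI a b γ k ψ τ) : IsImpulseResponse (fracIAdj a b γ k) τ U := by
  intro φ hφ ψ
  simp only [fracIAdj_eq_pairing hk, hU, pairing]
  have hc := continuous_fracI (a := a) (b := b) hk ψ
  exact hφ.tendsto_integral_mul hc.continuousAt hc.aestronglyMeasurable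

theorem exists_isInvFourier_fracIAdj (hk : γ.re < k + 1) (τ : ℝ) : ∃ U : 𝓢'(ℝ, ℂ),
    IsInvFourier (adjSymbol a b γ k (fourierDirac τ)) U ∧ ∀ ψ, U ψ = fracI a b γ k ψ τ := by
  obtain ⟨U, hU⟩ := (isTempered_adjSymbol_fourierDirac (a := a) (b := b) hk τ).exists_isInvFourier
  exact ⟨U, hU, hU.apply_eq_fracI⟩

/-- `kernelIAdj` and `kernelIAdjReg` unfold to `kernelI` and `kernelIReg` with $x$ and $\tau$
exchanged, so each claim on $U\psi$ is one on $(\mathrm I\psi)(\tau)$. -/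
theorem exists_impulseResponse_fracIAdj (hγ : ∀ n : ℤ, γ ≠ (n : ℂ)) (hγ0 : 0 < γ.re)
    (hk : γ.re < k + 1) (τ : ℝ) : ∃ U : 𝓢'(ℝ, ℂ),
      IsImpulseResponse (fracIAdj a b γ k) τ U ∧
      IsInvFourier (adjSymbol a b γ k (fourierDirac τ)) U ∧
      AgreesOn U (fun x => kernelIAdj a b γ k x τ) {0}ᶜ ∧
      ∀ ψ : 𝓢(ℝ, ℂ),
        Tendsto (fun ε : ℝ => ∫ x : ℝ, kernelIAdjReg a b γ k ε x τ * ψ x) (𝓝[>] 0)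
          (𝓝 (U ψ)) := by
  obtain ⟨U, hU, hUψ⟩ := exists_isInvFourier_fracIAdj (a := a) (b := b) hk τ
  refine ⟨U, isImpulseResponse_fracIAdj hk hUψ, hU, fun ψ hψ => ?_, fun ψ => ?_⟩
  · rw [hUψ]
    exact fracI_eq_integral_kernelI a b hγ hk ψ τ (Or.inl hγ0) (Or.inr fun h => hψ h rfl)
  · rw [hUψ]
    exact tendsto_integral_kernelIReg_mul hγ hk ψ τ

/-- At fixed $\varepsilon$ the damped symbol is integrable, which bounds the kernel by $M|x|^k$
uniformly in $\tau$. -/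
theorem integrable_prod_kernelIReg (hγ : ∀ n : ℤ, γ ≠ (n : ℂ)) (hk : γ.re < k + 1)
    (φ ψ : 𝓢(ℝ, ℂ)) {ε : ℝ} (hε : 0 < ε) :
    Integrable (fun q : ℝ × ℝ => kernelIReg a b γ k ε q.1 q.2 * φ q.1 * ψ q.2)
      (volume.prod volume) := by
  have hi := integrable_abs_rpow_mul_exp (p := k - γ.re) (by linarith) hε
  set M := ‖(1 / (2 * Real.pi) : ℂ)‖ * ((‖a‖⁻¹ + ‖b‖⁻¹) *
    ∫ ω : ℝ, |ω| ^ (k - γ.re) * Real.exp (-(ε * |ω|))) with hM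
  have hb : ∀ x τ, ‖kernelIReg a b γ k ε x τ‖ ≤ M * |x| ^ k := by
    intro x τ
    rw [kernelIReg_eq_integral a b hγ hk x τ hε, norm_mul, hM, mul_assoc]
    refine mul_le_mul_of_nonneg_left ?_ (norm_nonneg _)
    rw [mul_right_comm, ← integral_const_mul]
    refine norm_integral_le_of_norm_le (hi.const_mul _) (ae_of_all _ fun ω => ?_)
    rw [norm_mul, norm_fourierDirac, mul_one, norm_mul, Complex.norm_of_nonneg (Real.exp_nonneg _),
      ← mul_assoc]
    gcongr
    exact norm_intSymbol_le a b γ k x ω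
  refine (((integrable_abs_pow_mul φ k).mul_prod ψ.integrable).norm.const_mul M).mono' ?_
    (ae_of_all _ fun q => ?_)
  · exact (((measurable_kernelIReg a b γ k ε).mul (φ.continuous.measurable.comp measurable_fst)).mul
      (ψ.continuous.measurable.comp measurable_snd)).aestronglyMeasurable
  · simp only [norm_mul]
    rw [Complex.norm_of_nonneg (by positivity)]
    calc _ ≤ M * |q.1| ^ k * ‖φ q.1‖ * ‖ψ q.2‖ := by gcongr; exact hb _ _
      _ = _ := by ring

/-- After Fubini at fixed $\varepsilon$, the inner integral regularizes $\mathrm I\psi$; dominated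
convergence with majorant $C|\tau|^k|\varphi(\tau)|$ does the rest. -/
theorem tendsto_integral_integral_kernelIReg (hγ : ∀ n : ℤ, γ ≠ (n : ℂ)) (hk : γ.re < k + 1)
    (φ ψ : 𝓢(ℝ, ℂ)) :
    Tendsto (fun ε : ℝ => ∫ x : ℝ, (∫ τ : ℝ, kernelIReg a b γ k ε τ x * φ τ) * ψ x) (𝓝[>] 0)
      (𝓝 (fracIAdj a b γ k φ ψ)) := by
  rw [fracIAdj_eq_pairing hk, pairing]
  obtain ⟨C, hC, hb⟩ := exists_norm_integral_kernelIReg_mul_le (a := a) (b := b) hγ hk ψ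
  have key : Tendsto (fun ε : ℝ => ∫ τ : ℝ, (∫ x : ℝ, kernelIReg a b γ k ε τ x * ψ x) * φ τ)
      (𝓝[>] 0) (𝓝 (∫ τ, fracI a b γ k ψ τ * φ τ)) := by
    refine tendsto_integral_filter_of_dominated_convergence
      (fun τ => C * ‖((|τ| ^ k : ℝ) : ℂ) * φ τ‖) ?_ ?_
      ((integrable_abs_pow_mul φ k).norm.const_mul C) ?_
    · refine Eventually.of_forall fun ε => ?_
      have : Measurable (fun q : ℝ × ℝ => kernelIReg a b γ k ε q.1 q.2 * ψ q.2) :=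
        (measurable_kernelIReg a b γ k ε).mul (ψ.continuous.measurable.comp measurable_snd)
      exact this.stronglyMeasurable.integral_prod_right'.aestronglyMeasurable.mul
        φ.continuous.aestronglyMeasurable
    · filter_upwards [self_mem_nhdsWithin] with ε hε
      refine ae_of_all _ fun τ => ?_
      rw [norm_mul, norm_mul, Complex.norm_of_nonneg (by positivity), ← mul_assoc]
      gcongr
      exact hb ε τ hε
    · exact ae_of_all _ fun τ => (tendsto_integral_kernelIReg_mul hγ hk ψ τ).mul_const _
  refine key.congr' ?_
  filter_upwards [self_mem_nhdsWithin] with ε hε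
  have h := integral_integral_swap (f := fun τ x => kernelIReg a b γ k ε τ x * φ τ * ψ x)
    (integrable_prod_kernelIReg hγ hk φ ψ hε)
  simp only [← integral_mul_const]
  rw [← h]
  refine integral_congr_ae (ae_of_all _ fun t => integral_congr_ae (ae_of_all _ fun x => ?_))
  simp only; ring

/-- By adjointness $\psi$ becomes the input of the integrator, so restricting to tests supported off
$0$ supplies the support condition of its kernel formula. -/
theorem exists_distribution_fracIAdj (hγ : ∀ n : ℤ, γ ≠ (n : ℂ)) (hγ0 : 0 < γ.re)
    (hk : γ.re < k + 1) (φ : 𝓢(ℝ, ℂ)) : ∃ V : 𝓢'(ℝ, ℂ),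
      (∀ ψ : 𝓢(ℝ, ℂ), V ψ = fracIAdj a b γ k φ ψ) ∧
      (∀ x : ℝ, x ≠ 0 → Integrable (fun τ => kernelIAdj a b γ k x τ * φ τ)) ∧
      AgreesOn V (fun x => ∫ τ : ℝ, kernelIAdj a b γ k x τ * φ τ) {0}ᶜ ∧
      ∀ ψ : 𝓢(ℝ, ℂ),
        Tendsto (fun ε : ℝ => ∫ x : ℝ, (∫ τ : ℝ, kernelIAdjReg a b γ k ε x τ * φ τ) * ψ x) (𝓝[>] 0)
          (𝓝 (V ψ)) := by
  obtain ⟨V, hV⟩ := (isTempered_adjSymbol_angFourier (a := a) (b := b) hk φ).exists_isInvFourier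
  have hVψ : ∀ ψ : 𝓢(ℝ, ℂ), V ψ = fracIAdj a b γ k φ ψ := fun ψ => (hV ψ).2
  refine ⟨V, hVψ, fun x _ => (isTempered_kernelI_left a b hγ hγ0 k x).integrable_mul φ,
    fun ψ hψ => ?_, fun ψ => ?_⟩
  · have h0 : (0 : ℝ) ∉ tsupport ψ := fun h => hψ h rfl
    have hi := (integrable_prod_kernelI a b hγ hγ0 k ψ φ h0).integral_prod_left
    have e : ∀ x, (∫ τ, kernelI a b γ k τ x * φ τ) * ψ x =
        ∫ τ, kernelI a b γ k τ x * ψ x * φ τ := by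
      intro x
      rw [← integral_mul_const]
      refine integral_congr_ae (ae_of_all _ fun τ => ?_)
      simp only; ring
    refine ⟨hi.congr (ae_of_all _ fun x => (e x).symm), ?_⟩
    rw [hVψ, fracIAdj_eq_pairing hk, pairing]
    refine Eq.trans ?_ (integral_integral_kernelI (a := a) (b := b) (k := k) hγ hγ0 ψ φ h0).symm
    refine integral_congr_ae (ae_of_all _ fun τ => ?_)
    simp only
    rw [(fracI_eq_integral_kernelI a b hγ hk ψ τ (Or.inl hγ0) (Or.inr h0)).2]
  · rw [hVψ]
    exact tendsto_integral_integral_kernelIReg hγ hk φ ψ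

/-- For $k=0$ the operator is a pure Fourier multiplier; its transpose reflects the frequency, which
exchanges $a$ and $b$. -/
theorem pairing_fracI_zero (hk : γ.re < 1) (φ ψ : 𝓢(ℝ, ℂ)) :
    pairing (fracI a b γ 0 φ) ψ = fracIAdj b a γ 0 φ ψ := by
  rw [← fracIAdj_eq_pairing (by simpa using hk), fracIAdj, fracIAdj, ← integral_neg_eq_self]
  refine integral_congr_ae (ae_of_all _ fun ω => ?_)
  simp only [adjSymbol, Finset.range_zero, Finset.sum_empty, sub_zero, invAngFourier_eq, neg_neg,
    homMult_neg b a]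
  ring

end

/-! ### The derivative, as an integrator of order $-\gamma$. -/

theorem adjSymbol_inv_zero (a b γ : ℂ) (τ ω : ℝ) :
    adjSymbol b⁻¹ a⁻¹ (-γ) 0 (fourierDirac τ) ω = fourierDirac τ ω * homMult a b γ ω := by
  simp only [adjSymbol, Finset.range_zero, Finset.sum_empty, sub_zero]
  rw [homMult_neg, div_eq_mul_inv, inv_homMult, inv_inv, inv_inv, neg_neg]

theorem kernelDReg_symm (a b γ : ℂ) (ε x τ : ℝ) :
    kernelDReg a b γ ε x τ = kernelDReg b a γ ε τ x := by
  simp only [kernelDReg]; rw [add_comm (a / _)]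

theorem kernelD_symm (a b γ : ℂ) (x τ : ℝ) : kernelD a b γ x τ = kernelD b a γ τ x := by
  simp only [kernelD]; rw [add_comm (a / _)]

section

variable {a b γ : ℂ}

theorem fracD_eq_integral_kernelD (hγ : ∀ n : ℤ, γ ≠ (n : ℂ)) (hγ1 : -1 < γ.re)
    (φ : 𝓢(ℝ, ℂ)) (x : ℝ) (hx : x ∉ tsupport φ) :
    Integrable (fun τ => kernelD a b γ x τ * φ τ) ∧
      fracD a b γ φ x = ∫ τ : ℝ, kernelD a b γ x τ * φ τ := by
  have hγ' : ∀ n : ℤ, -γ ≠ (n : ℂ) := fun n h => hγ (-n) (by push_cast; rw [← h, neg_neg])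
  have hk : (-γ).re < ((0 : ℕ) : ℝ) + 1 := by simp; linarith
  simp only [kernelD_eq, fracD_eq]
  exact fracI_eq_integral_kernelI _ _ hγ' hk φ x (Or.inr hx) (Or.inl rfl)

theorem tendsto_integral_kernelDReg (hγ : ∀ n : ℤ, γ ≠ (n : ℂ)) (hγ1 : -1 < γ.re)
    (φ : 𝓢(ℝ, ℂ)) (x : ℝ) :
    Tendsto (fun ε : ℝ => ∫ τ : ℝ, kernelDReg a b γ ε x τ * φ τ) (𝓝[>] 0)
      (𝓝 (fracD a b γ φ x)) := by
  have hγ' : ∀ n : ℤ, -γ ≠ (n : ℂ) := fun n h => hγ (-n) (by push_cast; rw [← h, neg_neg])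
  have hk : (-γ).re < ((0 : ℕ) : ℝ) + 1 := by simp; linarith
  simp only [kernelDReg_eq, fracD_eq]
  exact tendsto_integral_kernelIReg_mul hγ' hk φ x

/-- The transpose of $\mathrm D_{a,b}$ is $\mathrm D_{b,a}$, so the response at $\tau$ is
$\psi\mapsto(\mathrm D_{b,a}\psi)(\tau)$; the kernel's symmetry under exchanging $a,b$ and $x,\tau$
restores the stated form. -/
theorem exists_impulseResponse_fracD (hγ : ∀ n : ℤ, γ ≠ (n : ℂ)) (hγ1 : -1 < γ.re) (τ : ℝ) :
    ∃ U : 𝓢'(ℝ, ℂ),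
      IsImpulseResponse (fun φ ψ => pairing (fracD a b γ φ) ψ) τ U ∧
      IsInvFourier (fun ω => fourierDirac τ ω * homMult a b γ ω) U ∧
      AgreesOn U (fun x => kernelD a b γ x τ) {τ}ᶜ ∧
      ∀ ψ : 𝓢(ℝ, ℂ),
        Tendsto (fun ε : ℝ => ∫ x : ℝ, kernelDReg a b γ ε x τ * ψ x) (𝓝[>] 0) (𝓝 (U ψ)) := by
  have hk : (-γ).re < ((0 : ℕ) : ℝ) + 1 := by simp; linarith
  obtain ⟨U, hU, hUψ⟩ := exists_isInvFourier_fracIAdj (a := b⁻¹) (b := a⁻¹) hk τ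
  have hUD : ∀ ψ, U ψ = fracD b a γ ψ τ := fun ψ => by rw [hUψ, fracD_eq]
  refine ⟨U, ?_, ?_, fun ψ hψ => ?_, fun ψ => ?_⟩
  · have h := isImpulseResponse_fracIAdj hk hUψ
    convert h using 3 with φ ψ
    rw [funext (fracD_eq a b γ φ), pairing_fracI_zero (by simpa using hk)]
  · rwa [funext (adjSymbol_inv_zero a b γ τ)] at hU
  · rw [hUD]
    simp only [kernelD_symm a b]
    exact fracD_eq_integral_kernelD hγ hγ1 ψ τ fun h => hψ h rfl
  · rw [hUD]
    simp only [kernelDReg_symm a b]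
    exact tendsto_integral_kernelDReg hγ hγ1 ψ τ

end

theorem mainTheorem4 (a b γ : ℂ) (ha : a ≠ 0) (hb : b ≠ 0) (hγ : ∀ n : ℤ, γ ≠ (n : ℂ)) :
    -- the derivative
    (-1 < γ.re →
      -- its response to a shifted Dirac impulse
      (∀ τ : ℝ, ∃ U : 𝓢'(ℝ, ℂ),
        IsImpulseResponse (fun φ ψ => pairing (fracD a b γ φ) ψ) τ U ∧
        IsInvFourier (fun ω => fourierDirac τ ω * homMult a b γ ω) U ∧
        AgreesOn U (fun x => kernelD a b γ x τ) {τ}ᶜ ∧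
        ∀ ψ : 𝓢(ℝ, ℂ),
          Tendsto (fun ε : ℝ => ∫ x : ℝ, kernelDReg a b γ ε x τ * ψ x) (𝓝[>] 0) (𝓝 (U ψ))) ∧
      -- its Schwartz kernel
      (∀ (φ : 𝓢(ℝ, ℂ)) (x : ℝ), x ∉ tsupport φ →
        Integrable (fun τ => kernelD a b γ x τ * φ τ) ∧
        fracD a b γ φ x = ∫ τ : ℝ, kernelD a b γ x τ * φ τ) ∧
      (∀ (φ : 𝓢(ℝ, ℂ)) (x : ℝ),
        Tendsto (fun ε : ℝ => ∫ τ : ℝ, kernelDReg a b γ ε x τ * φ τ) (𝓝[>] 0)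
          (𝓝 (fracD a b γ φ x)))) ∧
    -- the integrator and its adjoint
    (0 < γ.re → ∀ k : ℕ, 1 ≤ k → ⌊γ.re⌋ ≤ (k : ℤ) →
      -- the response of the integrator to a shifted Dirac impulse
      ((∀ τ : ℝ, τ ≠ 0 → ∃ U : 𝓢'(ℝ, ℂ),
          IsImpulseResponse (fun φ ψ => pairing (fracI a b γ k φ) ψ) τ U ∧
          AgreesOn U (fun x => kernelI a b γ k x τ) Set.univ) ∧
        -- its Schwartz kernel
        (∀ φ : 𝓢(ℝ, ℂ), (0 : ℝ) ∉ tsupport φ → ∀ x : ℝ,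
          Integrable (fun τ => kernelI a b γ k x τ * φ τ) ∧
          fracI a b γ k φ x = ∫ τ : ℝ, kernelI a b γ k x τ * φ τ) ∧
        (∀ (φ : 𝓢(ℝ, ℂ)) (x : ℝ),
          Tendsto (fun ε : ℝ => ∫ τ : ℝ, kernelIReg a b γ k ε x τ * φ τ) (𝓝[>] 0)
            (𝓝 (fracI a b γ k φ x)))) ∧
      -- the response of the adjoint integrator to a shifted Dirac impulse
      ((∀ τ : ℝ, ∃ U : 𝓢'(ℝ, ℂ),
          IsImpulseResponse (fracIAdj a b γ k) τ U ∧
          IsInvFourier (adjSymbol a b γ k (fourierDirac τ)) U ∧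
          AgreesOn U (fun x => kernelIAdj a b γ k x τ) {0}ᶜ ∧
          ∀ ψ : 𝓢(ℝ, ℂ),
            Tendsto (fun ε : ℝ => ∫ x : ℝ, kernelIAdjReg a b γ k ε x τ * ψ x) (𝓝[>] 0)
              (𝓝 (U ψ))) ∧
        -- its Schwartz kernel
        (∀ φ : 𝓢(ℝ, ℂ), ∃ V : 𝓢'(ℝ, ℂ),
          (∀ ψ : 𝓢(ℝ, ℂ), V ψ = fracIAdj a b γ k φ ψ) ∧
          (∀ x : ℝ, x ≠ 0 → Integrable (fun τ => kernelIAdj a b γ k x τ * φ τ)) ∧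
          AgreesOn V (fun x => ∫ τ : ℝ, kernelIAdj a b γ k x τ * φ τ) {0}ᶜ ∧
          ∀ ψ : 𝓢(ℝ, ℂ),
            Tendsto (fun ε : ℝ =>
                ∫ x : ℝ, (∫ τ : ℝ, kernelIAdjReg a b γ k ε x τ * φ τ) * ψ x) (𝓝[>] 0)
              (𝓝 (V ψ))))) := by
  refine ⟨fun h => ⟨exists_impulseResponse_fracD hγ h, fracD_eq_integral_kernelD hγ h,
    tendsto_integral_kernelDReg hγ h⟩, fun hγ0 k _ hfl => ?_⟩
  -- The floor condition enters only through this inequality, local integrability of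
  -- $|\omega|^{k-\operatorname{Re}\gamma}$ at $0$.
  have hk : γ.re < k + 1 := by
    have h1 : ((⌊γ.re⌋ : ℤ) : ℝ) ≤ ((k : ℤ) : ℝ) := by exact_mod_cast hfl
    have := Int.lt_floor_add_one γ.re
    push_cast at h1
    linarith
  exact ⟨⟨fun τ hτ => exists_impulseResponse_fracI hγ hγ0 hk hτ,
    fun φ h0 x => fracI_eq_integral_kernelI a b hγ hk φ x (Or.inl hγ0) (Or.inr h0),
    tendsto_integral_kernelIReg_mul hγ hk⟩,
    exists_impulseResponse_fracIAdj hγ hγ0 hk, exists_distribution_fracIAdj hγ hγ0 hk⟩
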